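/- Let $\lambda$ be Lebesgue measure on $\mathbb R^d$ and $\mathcal H=L^2(\mathbb R^d,\lambda;\mathbb C)$. A Lévy process is a process $(Y_t)_{t\ge 0}$ on a probability space with values in $\mathbb R^d$ such that $Y_0=0$ a.s.; for $0\le s\le t$ the increment $Y_t-Y_s$ is independent of $(Y_u)_{0\le u\le s}$ and has the law of $Y_{t-s}$; and $Y_t\to 0$ in probability as $t\to 0$. Let $(X_t)_{t\ge 0}$ be an $\mathbb R^d$-valued process on a measure space such that every $X_t$ has law $\lambda$ and such that $(X_t-X_0)_{t\ge0}$ is a Lévy process independent of $X_0$, that is, the law of $(X_0,(X_t-X_0)_{t\ge 0})$ is $\lambda\otimes Q$, where $Q$ is a probability measure on $(\mathbb R^d)^{\mathbb R_+}$ (with the $\sigma$-algebra of cylinder sets) under which the coordinate process is a Lévy process. Let $(P_t)_{t\ge0}$ be its semigroup on $L^\infty(\lambda)$: $P_tf(X_s)=\mathbb E[f(X_{s+t})\mid X_s]$ for all $s,t\ge 0$ and $f\in L^\infty(\lambda)$. Let $F=\{\omega:\mathbb R\to\mathbb R^d : \omega_0=0\}$ with the $\sigma$-algebra of cylinder sets,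 and let $\nu$ be the law on $F$ of the two-sided process $(\hat Y_t)_{t\in\mathbb R}$ with $\hat Y_t=Y_t$ and $\hat Y_{-t}=-Y'_t$ for $t\ge 0$, where $Y,Y'$ are independent with law $Q$. For $t\in\mathbb R$ put $(\eta_t\omega)_s=\omega_{s+t}-\omega_t$ on $F$ and $\theta_t(x,\omega)=(x+\omega_t,\eta_t\omega)$ on $\mathbb R^d\times F$. Let $\mathcal K=L^2(F,\nu)$, identify $\mathcal H\otimes\mathcal K$ with $L^2(\lambda\otimes\nu)$, and define $U_th=h\circ\theta_t^{-1}$ on $\mathcal H\otimes\mathcal K$, $\Theta_t\varphi=\varphi\circ\eta_t$ on $\mathcal K$, and, for $t\ge 0$, $$V_t=(I\otimes\Theta_t)^*U_t,\qquad \mathcal P_t(A)=\mathrm{Tr}_{|\mathbf 1\rangle\langle\mathbf 1|}\big[V_t^*(A\otimes I)V_t\big],\quad A\in\mathcal B(\mathcal H),$$ where $\mathrm{Tr}_{|\mathbf 1\rangle\langle\mathbf 1|}[B]$ is the operator on $\mathcal H$ with $\langle\varphi,\mathrm{Tr}_{|\mathbf 1\rangle\langle\mathbf 1|}[B]\psi\rangle=\langle\varphi\otimes\mathbf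 1,B(\psi\otimes\mathbf 1)\rangle$. Then $\eta_t$ preserves $\nu$ and $\theta_t$ preserves $\lambda\otimes\nu$ for all $t\in\mathbb R$ (so that these operators are well defined), and $(\mathcal P_t)_{t\ge0}$ is a quantum Markov semigroup extending $(P_t)$: each $\mathcal P_t$ is linear, completely positive, normal (continuous for the $\sigma$-weak topology) and satisfies $\mathcal P_t(I)=I$; $\mathcal P_0=\mathrm{id}$ and $\mathcal P_{s+t}=\mathcal P_s\mathcal P_t$; for every $A\in\mathcal B(\mathcal H)$ the map $t\mapsto\mathcal P_t(A)$ is weak*-continuous on $[0,\infty)$; and $\mathcal P_t(M_f)=M_{P_tf}$ for all $t\ge0$ and $f\in L^\infty(\lambda)$, where $M_f$ is multiplication by $f$ on $\mathcal H$. -/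

import Mathlib

open MeasureTheory ProbabilityTheory Filter Topology
open scoped NNReal ENNReal InnerProductSpace TensorProduct CStarAlgebra

namespace LevyQuantum

noncomputable section

/-! ### Quantum Markov semigroups on `B(H)` -/

/-- The `σ`-weak (weak*) topology on `B(H)`: the coarsest topology making continuous all functionals
`A ↦ Tr (A ρ) = ∑ₙ ⟪φₙ, A ψₙ⟫`, where `ρ = ∑ₙ |ψₙ⟩⟨φₙ|` with `∑ₙ ‖φₙ‖² < ∞` and `∑ₙ ‖ψₙ‖² < ∞`
is an arbitrary trace class operator. -/
@[reducible] def sigmaWeak (H : Type*) [NormedAddCommGroup H] [InnerProductSpace ℂ H] :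
    TopologicalSpace (H →L[ℂ] H) :=
  ⨅ p : {p : (ℕ → H) × (ℕ → H) //
      Summable (fun n => ‖p.1 n‖ ^ 2) ∧ Summable (fun n => ‖p.2 n‖ ^ 2)},
    TopologicalSpace.induced
      (fun A : H →L[ℂ] H => ∑' n, ⟪p.1.1 n, A (p.1.2 n)⟫_ℂ) inferInstance

/-- A quantum Markov semigroup on `B(H)`: a weak*-continuous one-parameter semigroup of completely
positive, normal, identity preserving maps. -/
structure IsQuantumMarkovSemigroup {H : Type*} [NormedAddCommGroup H] [InnerProductSpace ℂ H]
    [CompleteSpace H] (Φ : ℝ≥0 → (H →L[ℂ] H) → (H →L[ℂ] H)) : Prop where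
  completelyPositive : ∀ t, ∃ Ψ : (H →L[ℂ] H) →CP (H →L[ℂ] H), ∀ A, Ψ A = Φ t A
  normal : ∀ t, Continuous[sigmaWeak H, sigmaWeak H] (Φ t)
  map_one : ∀ t, Φ t 1 = 1
  zero : ∀ A, Φ 0 A = A
  add : ∀ s t A, Φ (s + t) A = Φ s (Φ t A)
  weakStarContinuous : ∀ A, Continuous[inferInstance, sigmaWeak H] (fun t => Φ t A)

/-! ### Operators on `L²` spaces -/

section L2

variable {α β : Type*} [MeasurableSpace α] [MeasurableSpace β]

/-- The multiplication operator `M_f` on `L²(μ)`, for `f ∈ L^∞(μ)`. -/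
def mulOp (μ : Measure α) (f : Lp ℂ ∞ μ) : Lp ℂ 2 μ →L[ℂ] Lp ℂ 2 μ :=
  (ContinuousLinearMap.mul ℂ ℂ).holderL μ ∞ 2 2 f

open Classical in
/-- The Koopman operator `h ↦ h ∘ T` on `L²(μ)` of a `μ`-preserving map `T`
(by convention `0` if `T` does not preserve `μ`). -/
def koopman (μ : Measure α) (T : α → α) : Lp ℂ 2 μ →L[ℂ] Lp ℂ 2 μ :=
  if hT : MeasurePreserving T μ μ then
    (Lp.compMeasurePreservingₗᵢ ℂ T hT).toContinuousLinearMap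
  else 0

theorem eLpNorm_tensor {μ : Measure α} {ν : Measure β} [SFinite ν]
    {f : α → ℂ} {g : β → ℂ} (hf : AEStronglyMeasurable f μ) (hg : AEStronglyMeasurable g ν) :
    eLpNorm (fun p : α × β => f p.1 * g p.2) 2 (μ.prod ν) = eLpNorm f 2 μ * eLpNorm g 2 ν := by
  rw [eLpNorm_eq_lintegral_rpow_enorm_toReal (by norm_num) (by norm_num),
    eLpNorm_eq_lintegral_rpow_enorm_toReal (by norm_num) (by norm_num),
    eLpNorm_eq_lintegral_rpow_enorm_toReal (by norm_num) (by norm_num),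
    ← ENNReal.mul_rpow_of_nonneg _ _ (by norm_num),
    ← lintegral_prod_mul (hf.enorm.pow_const _) (hg.enorm.pow_const _)]
  simp only [enorm_mul]
  congr 2
  ext p
  rw [ENNReal.mul_rpow_of_nonneg _ _ (by norm_num)]

theorem memLp_tensor {μ : Measure α} {ν : Measure β} [SFinite ν]
    (f : Lp ℂ 2 μ) (g : Lp ℂ 2 ν) :
    MemLp (fun p : α × β => f p.1 * g p.2) 2 (μ.prod ν) := by
  refine ⟨(Lp.aestronglyMeasurable f).comp_fst.mul (Lp.aestronglyMeasurable g).comp_snd, ?_⟩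
  rw [eLpNorm_tensor (Lp.aestronglyMeasurable f) (Lp.aestronglyMeasurable g)]
  exact ENNReal.mul_lt_top (Lp.eLpNorm_lt_top f) (Lp.eLpNorm_lt_top g)

/-- The tensor product `f ⊗ g : (x, y) ↦ f x * g y` of `f ∈ L²(μ)` and `g ∈ L²(ν)`, as an element of
`L²(μ ⊗ ν)`, which is the Hilbert space tensor product `L²(μ) ⊗ L²(ν)`. -/
def tensor (μ : Measure α) (ν : Measure β) [SFinite μ] [SFinite ν] :
    Lp ℂ 2 μ →L[ℂ] Lp ℂ 2 ν →L[ℂ] Lp ℂ 2 (μ.prod ν) :=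
  LinearMap.mkContinuous₂
    (LinearMap.mk₂ ℂ (fun f g => (memLp_tensor f g).toLp _)
      (fun f₁ f₂ g => by
        rw [← MemLp.toLp_add (memLp_tensor _ _) (memLp_tensor _ _)]
        apply MemLp.toLp_congr
        filter_upwards [Measure.quasiMeasurePreserving_fst.ae (Lp.coeFn_add f₁ f₂)] with p hp
        rw [hp]; simp [add_mul])
      (fun c f g => by
        rw [← MemLp.toLp_const_smul]
        apply MemLp.toLp_congr
        filter_upwards [Measure.quasiMeasurePreserving_fst.ae (Lp.coeFn_smul c f)] with p hp
        simp [hp, mul_assoc])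
      (fun f g₁ g₂ => by
        rw [← MemLp.toLp_add (memLp_tensor _ _) (memLp_tensor _ _)]
        apply MemLp.toLp_congr
        filter_upwards [Measure.quasiMeasurePreserving_snd.ae (Lp.coeFn_add g₁ g₂)] with p hp
        rw [hp]; simp [mul_add])
      (fun c f g => by
        rw [← MemLp.toLp_const_smul]
        apply MemLp.toLp_congr
        filter_upwards [Measure.quasiMeasurePreserving_snd.ae (Lp.coeFn_smul c g)] with p hp
        simp [hp, mul_left_comm]))
    1 (fun f g => by
      rw [LinearMap.mk₂_apply, Lp.norm_toLp,
        eLpNorm_tensor (Lp.aestronglyMeasurable f) (Lp.aestronglyMeasurable g),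
        ENNReal.toReal_mul, one_mul, Lp.norm_def, Lp.norm_def])

/-- The canonical map from the algebraic tensor product into `L²(μ ⊗ ν)`; it is isometric with
dense range. -/
def tensorIncl (μ : Measure α) (ν : Measure β) [SFinite μ] [SFinite ν] :
    Lp ℂ 2 μ ⊗[ℂ] Lp ℂ 2 ν →ₗ[ℂ] Lp ℂ 2 (μ.prod ν) :=
  TensorProduct.lift (tensor μ ν).toLinearMap₁₂

/-- The tensor product `X ⊗ Y` of bounded operators, i.e. the unique bounded operator on
`L²(μ ⊗ ν)` mapping `f ⊗ g` to `X f ⊗ Y g`: the extension by continuity of the algebraic tensor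
product of `X` and `Y`. -/
def tensorOp (μ : Measure α) (ν : Measure β) [SFinite μ] [SFinite ν]
    (X : Lp ℂ 2 μ →L[ℂ] Lp ℂ 2 μ) (Y : Lp ℂ 2 ν →L[ℂ] Lp ℂ 2 ν) :
    Lp ℂ 2 (μ.prod ν) →L[ℂ] Lp ℂ 2 (μ.prod ν) :=
  LinearMap.extendOfNorm
    (tensorIncl μ ν ∘ₗ TensorProduct.map (X : Lp ℂ 2 μ →ₗ[ℂ] Lp ℂ 2 μ) (Y : Lp ℂ 2 ν →ₗ[ℂ] Lp ℂ 2 ν))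
    (tensorIncl μ ν)

/-- The partial trace `Tr_{|χ⟩⟨χ|}[A]` over the pure state `|χ⟩⟨χ|` of `L²(ν)`: the operator on
`L²(μ)` with `⟪φ, Tr_{|χ⟩⟨χ|}[A] ψ⟫ = ⟪φ ⊗ χ, A (ψ ⊗ χ)⟫`. -/
def partialTrace (μ : Measure α) (ν : Measure β) [SFinite μ] [SFinite ν] (χ : Lp ℂ 2 ν)
    (A : Lp ℂ 2 (μ.prod ν) →L[ℂ] Lp ℂ 2 (μ.prod ν)) : Lp ℂ 2 μ →L[ℂ] Lp ℂ 2 μ :=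
  ContinuousLinearMap.adjoint ((tensor μ ν).flip χ) ∘L A ∘L (tensor μ ν).flip χ

theorem inner_partialTrace (μ : Measure α) (ν : Measure β) [SFinite μ] [SFinite ν]
    (χ : Lp ℂ 2 ν) (A : Lp ℂ 2 (μ.prod ν) →L[ℂ] Lp ℂ 2 (μ.prod ν)) (φ ψ : Lp ℂ 2 μ) :
    ⟪φ, partialTrace μ ν χ A ψ⟫_ℂ = ⟪tensor μ ν φ χ, A (tensor μ ν ψ χ)⟫_ℂ := by
  simp [partialTrace, ContinuousLinearMap.adjoint_inner_right]

end L2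

/-! ### Lévy processes -/

/-- Lévy processes with values in `ℝ^d`. -/
structure IsLevyProcess {d : ℕ} {Ω : Type*} [MeasurableSpace Ω]
    (Y : ℝ≥0 → Ω → EuclideanSpace ℝ (Fin d)) (P : Measure Ω) [IsProbabilityMeasure P] : Prop where
  measurable : ∀ t, Measurable (Y t)
  zero : ∀ᵐ ω ∂P, Y 0 ω = 0
  indep : ∀ s t, s ≤ t →
    IndepFun (fun ω => Y t ω - Y s ω) (fun ω (u : Set.Iic s) => Y u ω) P
  stationary : ∀ s t, s ≤ t →
    IdentDistrib (fun ω => Y t ω - Y s ω) (Y (t - s)) P P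
  tendsto : TendstoInMeasure P Y (𝓝 0) (fun _ => 0)

/-- `X` is a Lebesgue measure preserving process (in particular `X 0` has law the Lebesgue measure
`λ`, and `Pr` is an infinite measure if `d ≥ 1`) such that `(X t - X 0)` is a Lévy process, of law
`Q` on path space, started independently of `X 0`: the law of the pair `(X 0, (X t - X 0)_t)` is
the product measure `λ ⊗ Q`. -/
structure IsLebesgueLevy {d : ℕ} {Ω : Type*} [MeasurableSpace Ω] (Pr : Measure Ω)
    (X : ℝ≥0 → Ω → EuclideanSpace ℝ (Fin d)) (Q : Measure (ℝ≥0 → EuclideanSpace ℝ (Fin d)))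
    [IsProbabilityMeasure Q] : Prop where
  preserving : ∀ t, MeasurePreserving (X t) Pr volume
  law : Pr.map (fun ω => (X 0 ω, fun t => X t ω - X 0 ω)) = volume.prod Q
  levy : IsLevyProcess (fun (t : ℝ≥0) (w : ℝ≥0 → EuclideanSpace ℝ (Fin d)) => w t) Q

/-- `P` is the semigroup on `L^∞(ℝ^d)` associated to the process `X`:
`P_t f (X_s) = 𝔼[f (X_{s+t}) | X_s]` for all `f ∈ L^∞`. As the law of `X_s` is the (infinite)
Lebesgue measure, conditional expectations are tested on the events `{X_s ∈ A}` with `A` of finite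
measure. -/
def IsSemigroupOf {d : ℕ} {Ω : Type*} [MeasurableSpace Ω] (Pr : Measure Ω)
    (X : ℝ≥0 → Ω → EuclideanSpace ℝ (Fin d))
    (P : ℝ≥0 → Lp ℂ ∞ (volume : Measure (EuclideanSpace ℝ (Fin d))) →
      Lp ℂ ∞ (volume : Measure (EuclideanSpace ℝ (Fin d)))) : Prop :=
  ∀ (s t : ℝ≥0) (f : Lp ℂ ∞ (volume : Measure (EuclideanSpace ℝ (Fin d))))
    (A : Set (EuclideanSpace ℝ (Fin d))), MeasurableSet A → volume A < ∞ →
    ∫ ω in X s ⁻¹' A, P t f (X s ω) ∂Pr = ∫ ω in X s ⁻¹' A, f (X (s + t) ω) ∂Pr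

/-! ### The two-sided canonical space and the shifts -/

/-- The two-sided path space: all paths `ℝ → ℝ^d` vanishing at time `0`, with the `σ`-algebra of
cylinder sets. -/
abbrev PathSpace (d : ℕ) : Type := {w : ℝ → EuclideanSpace ℝ (Fin d) // w 0 = 0}

/-- Gluing of two one-sided paths `w`, `w'` into a two-sided path, equal to `w t - w 0` for `t ≥ 0`
and to `-(w' (-t) - w' 0)` for `t ≤ 0`. -/
def glue {d : ℕ} (p : (ℝ≥0 → EuclideanSpace ℝ (Fin d)) × (ℝ≥0 → EuclideanSpace ℝ (Fin d))) :
    PathSpace d :=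
  ⟨fun t => (p.1 t.toNNReal - p.1 0) - (p.2 (-t).toNNReal - p.2 0), by simp⟩

theorem measurable_glue {d : ℕ} : Measurable (glue (d := d)) :=
  Measurable.subtype_mk (by fun_prop)

/-- The law of the two-sided Lévy process with value `0` at time `0`, built from two independent
copies of the process of law `Q`. -/
def twoSided {d : ℕ} (Q : Measure (ℝ≥0 → EuclideanSpace ℝ (Fin d))) : Measure (PathSpace d) :=
  (Q.prod Q).map glue

instance {d : ℕ} (Q : Measure (ℝ≥0 → EuclideanSpace ℝ (Fin d))) [IsProbabilityMeasure Q] :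
    IsProbabilityMeasure (twoSided Q) :=
  Measure.isProbabilityMeasure_map measurable_glue.aemeasurable

@[fun_prop]
theorem measurable_eval {d : ℕ} (s : ℝ) : Measurable (fun w : PathSpace d => w.1 s) :=
  (measurable_pi_apply s).comp measurable_subtype_coe

/-- The shift of increments `(η_t w)_s = w_{s+t} - w_t`, as a map. -/
def incShiftFun {d : ℕ} (t : ℝ) (w : PathSpace d) : PathSpace d :=
  ⟨fun s => w.1 (s + t) - w.1 t, by simp⟩

@[fun_prop]
theorem measurable_incShiftFun {d : ℕ} (t : ℝ) : Measurable (incShiftFun (d := d) t) :=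
  Measurable.subtype_mk (measurable_pi_lambda _ fun s =>
    (measurable_eval (s + t)).sub (measurable_eval t))

theorem incShiftFun_incShiftFun {d : ℕ} {s t : ℝ} (h : s + t = 0) (w : PathSpace d) :
    incShiftFun s (incShiftFun t w) = w := by
  ext1
  funext r
  simp [incShiftFun, w.2, add_assoc, h]

/-- The shift of increments `(η_t w)_s = w_{s+t} - w_t`, with inverse `η_{-t}`. -/
def incShift {d : ℕ} (t : ℝ) : PathSpace d ≃ᵐ PathSpace d where
  toFun := incShiftFun t
  invFun := incShiftFun (-t)
  left_inv := incShiftFun_incShiftFun (by simp)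
  right_inv := incShiftFun_incShiftFun (by simp)
  measurable_toFun := measurable_incShiftFun t
  measurable_invFun := measurable_incShiftFun (-t)

/-- The shift `θ_t (x, w) = (x + w_t, η_t w)` on `ℝ^d × PathSpace d`, with inverse `θ_{-t}`. -/
def shift {d : ℕ} (t : ℝ) :
    EuclideanSpace ℝ (Fin d) × PathSpace d ≃ᵐ EuclideanSpace ℝ (Fin d) × PathSpace d where
  toFun p := (p.1 + p.2.1 t, incShiftFun t p.2)
  invFun p := (p.1 + p.2.1 (-t), incShiftFun (-t) p.2)
  left_inv p := by
    ext1
    · simp [incShiftFun, p.2.2]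
    · exact incShiftFun_incShiftFun (by simp) p.2
  right_inv p := by
    ext1
    · simp [incShiftFun, p.2.2]
    · exact incShiftFun_incShiftFun (by simp) p.2
  measurable_toFun := (measurable_fst.add ((measurable_eval t).comp measurable_snd)).prodMk
    ((measurable_incShiftFun t).comp measurable_snd)
  measurable_invFun := (measurable_fst.add ((measurable_eval (-t)).comp measurable_snd)).prodMk
    ((measurable_incShiftFun (-t)).comp measurable_snd)

/-! ### The quantum semigroup of a Lévy process -/

section QMS

variable {d : ℕ} (Q : Measure (ℝ≥0 → EuclideanSpace ℝ (Fin d))) [IsProbabilityMeasure Q]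

/-- `U_t h = h ∘ θ_t⁻¹` on `L²(λ ⊗ ν)`, where `ν` is the two-sided law. -/
def shiftOp (t : ℝ) : Lp ℂ 2 ((volume : Measure (EuclideanSpace ℝ (Fin d))).prod (twoSided Q)) →L[ℂ]
    Lp ℂ 2 ((volume : Measure (EuclideanSpace ℝ (Fin d))).prod (twoSided Q)) :=
  koopman _ (shift t).symm

/-- `Θ_t φ = φ ∘ η_t` on `L²(ν)`. -/
def incShiftOp (t : ℝ) : Lp ℂ 2 (twoSided Q) →L[ℂ] Lp ℂ 2 (twoSided Q) :=
  koopman _ (incShift t)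

/-- The cocycle `V_t = (I ⊗ Θ_t)^* U_t`. -/
def cocycle (t : ℝ) : Lp ℂ 2 ((volume : Measure (EuclideanSpace ℝ (Fin d))).prod (twoSided Q)) →L[ℂ]
    Lp ℂ 2 ((volume : Measure (EuclideanSpace ℝ (Fin d))).prod (twoSided Q)) :=
  ContinuousLinearMap.adjoint (tensorOp volume (twoSided Q) 1 (incShiftOp Q t)) ∘L shiftOp Q t

/-- `𝒫_t(A) = Tr_{|1⟩⟨1|}[V_t^* (A ⊗ I) V_t]`. -/
def levyQMS (t : ℝ≥0)
    (A : Lp ℂ 2 (volume : Measure (EuclideanSpace ℝ (Fin d))) →L[ℂ]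
      Lp ℂ 2 (volume : Measure (EuclideanSpace ℝ (Fin d)))) :
    Lp ℂ 2 (volume : Measure (EuclideanSpace ℝ (Fin d))) →L[ℂ]
      Lp ℂ 2 (volume : Measure (EuclideanSpace ℝ (Fin d))) :=
  partialTrace volume (twoSided Q) (Lp.const 2 (twoSided Q) 1)
    (ContinuousLinearMap.adjoint (cocycle Q t) ∘L tensorOp volume (twoSided Q) A 1 ∘L cocycle Q t)

end QMS

end

end LevyQuantum

/-! Everything rests on one formula. Write `μ_t` for the law of `Y_t` and `τ_y ψ = ψ(· - y)`. Both
factors of `V_t` are composition operators, so `V_t` is composition with a measure preserving map,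
and `V_t (ψ ⊗ 1)(x, w) = ψ(x - (w_{-t} - w_{-2t}))`, because the function `1` does not see the
change of path. The increment over `[-2t, -t]` has law `μ_t`, hence `⟪φ, 𝒫_t(A) ψ⟫ = ∫ ⟪τ_y φ, A τ_y
ψ⟫ dμ_t(y)` (`IsLevyProcess.inner_levyQMS`): `𝒫_t(A)` is the average of `τ_y^* A τ_y`.

The semigroup law is then `μ_{s+t} = μ_s ∗ μ_t`, and weak* continuity comes from weak continuity of
`t ↦ μ_t` together with strong continuity of translations. Since `τ_y^* M_f τ_y = M_{f(· + y)}`, the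
restriction to multiplication operators is convolution of `f` with the law of `-Y_t`, which is also
what the defining property of `P_t` gives at starting time `0` (`IsSemigroupOf.ae_eq_integral`).

Complete positivity and normality do not need the formula. Slicing `V_t (φ ⊗ 1)` along an
orthonormal basis of the path factor gives a Kraus decomposition (`hasKraus_partialTrace`), and any
unital map with such a decomposition is completely positive and `σ`-weakly continuous.

Invariance of the two-sided law under `η_t` is checked on finite-dimensional marginals: increments
over consecutive intervals are independent, with laws depending only on the lengths
(`IsLevyProcess.map_twoSided_increments`). Invariance under `θ_t` follows because each fibre map is
a translation of Lebesgue measure. -/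

namespace LevyQuantum

/-! ### Positivity in C⋆-algebras and Kraus maps -/

/-- A self-adjoint element `a` of a C⋆-algebra which is not positive can be compressed to a nonzero
negative element. -/
theorem exists_star_conjugate_eq_neg {A : Type*} [NonUnitalCStarAlgebra A] [PartialOrder A]
    [StarOrderedRing A] {a : A} (ha : IsSelfAdjoint a) :
    ∃ b c : A, star b * (a * b) = -(star c * c) ∧ (c = 0 → 0 ≤ a) := by
  have hneg : 0 ≤ a⁻ := CFC.negPart_nonneg a
  have hsa : star a⁻ = a⁻ := hneg.isSelfAdjoint
  have hcube : 0 ≤ a⁻ * a⁻ * a⁻ := by simpa [hsa] using star_left_conjugate_nonneg hneg a⁻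
  obtain ⟨c, hc⟩ := CStarAlgebra.nonneg_iff_eq_star_mul_self.1 hcube
  -- Compressing by `a⁻` gives `-(a⁻)³`. If `(a⁻)³ = 0` then `(a⁻)⁴ = 0`, and the C⋆-identity
  -- applied twice gives `a⁻ = 0`.
  refine ⟨a⁻, c, ?_, fun h0 => ?_⟩
  · have hab : a * a⁻ = -(a⁻ * a⁻) := by
      nth_rewrite 1 [← CFC.posPart_sub_negPart a ha]
      rw [sub_mul, CFC.posPart_mul_negPart, zero_sub]
    rw [hsa, hab, ← hc, mul_neg, mul_assoc]
  · rw [h0, mul_zero] at hc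
    have h4 : star (a⁻ * a⁻) * (a⁻ * a⁻) = 0 := by
      rw [star_mul, hsa, ← mul_assoc, hc, zero_mul]
    have h5 : star a⁻ * a⁻ = 0 := by
      rw [hsa]; exact (CStarRing.star_mul_self_eq_zero_iff _).1 h4
    exact (CFC.negPart_eq_zero_iff a ha).1 ((CStarRing.star_mul_self_eq_zero_iff _).1 h5)

theorem exists_eq_star_mul_self {A : Type*} [NonUnitalCStarAlgebra A] [PartialOrder A]
    [StarOrderedRing A] {a : A} (ha : 0 ≤ a) : ∃ c : A, a = star c * c :=
  CStarAlgebra.nonneg_iff_eq_star_mul_self.1 ha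

section KrausMaps

open scoped ComplexOrder

variable {H : Type*} [NormedAddCommGroup H] [InnerProductSpace ℂ H]

theorem inner_self_nonneg_complex (v : H) : 0 ≤ ⟪v, v⟫_ℂ := by
  rw [inner_self_eq_norm_sq_to_K]
  exact pow_nonneg (Complex.zero_le_real.2 (norm_nonneg v)) 2

/-- The action of a matrix of bounded operators on a tuple of vectors. -/
def matrixAct {n : Type*} [Fintype n] (M : CStarMatrix n n (H →L[ℂ] H)) (x : n → H) : n → H :=
  fun i => ∑ j, M i j (x j)

/-- The quadratic form of a matrix of bounded operators. -/
noncomputable def matrixForm {n : Type*} [Fintype n] (M : CStarMatrix n n (H →L[ℂ] H))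
    (x y : n → H) : ℂ :=
  ∑ i, ⟪x i, matrixAct M y i⟫_ℂ

theorem matrixAct_mul {n : Type*} [Fintype n] (M N : CStarMatrix n n (H →L[ℂ] H)) (x : n → H) :
    matrixAct (M * N) x = matrixAct M (matrixAct N x) := by
  funext i
  simp only [matrixAct, CStarMatrix.mul_apply, sum_apply,
    mul_apply_eq_comp, map_sum]
  exact Finset.sum_comm

variable [CompleteSpace H]

theorem matrixForm_star {n : Type*} [Fintype n] (M : CStarMatrix n n (H →L[ℂ] H)) (x y : n → H) :
    matrixForm (star M) x y = ∑ i, ⟪matrixAct M x i, y i⟫_ℂ := by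
  simp only [matrixForm, matrixAct, inner_sum, sum_inner, CStarMatrix.star_apply,
    ContinuousLinearMap.star_eq_adjoint, ContinuousLinearMap.adjoint_inner_right]
  exact Finset.sum_comm

theorem matrixForm_star_mul {n : Type*} [Fintype n] (M N : CStarMatrix n n (H →L[ℂ] H))
    (x y : n → H) :
    matrixForm (star M * N) x y = ∑ i, ⟪matrixAct M x i, matrixAct N y i⟫_ℂ := by
  rw [← matrixForm_star, matrixForm, matrixForm, matrixAct_mul]

theorem matrixForm_self_nonneg {n : Type*} [Fintype n] {M : CStarMatrix n n (H →L[ℂ] H)}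
    (hM : 0 ≤ M) (x : n → H) : 0 ≤ matrixForm M x x := by
  obtain ⟨C, rfl⟩ := exists_eq_star_mul_self hM
  rw [matrixForm_star_mul]
  exact Finset.sum_nonneg fun i _ => inner_self_nonneg_complex _

/-- A self-adjoint matrix of bounded operators is positive if its quadratic form is. -/
theorem nonneg_of_matrixForm_nonneg {n : Type*} [Fintype n]
    {M : CStarMatrix n n (H →L[ℂ] H)} (hM : IsSelfAdjoint M)
    (h : ∀ x, 0 ≤ matrixForm M x x) : 0 ≤ M := by
  classical
  obtain ⟨N, C, hMn, hC0⟩ := exists_star_conjugate_eq_neg hM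
  have hform : ∀ x, ∑ i, ⟪matrixAct C x i, matrixAct C x i⟫_ℂ = 0 := by
    intro x
    -- The form of `star C * C` is nonnegative as a sum of squares. It is also minus the form of `M`
    -- evaluated at `N x`, hence nonpositive.
    apply le_antisymm
    · have h1 := h (matrixAct N x)
      have h2 : matrixForm M (matrixAct N x) (matrixAct N x)
          = matrixForm (star N * (M * N)) x x := by
        rw [matrixForm_star_mul, matrixAct_mul]; rfl
      rw [h2, hMn] at h1
      have h3 : matrixForm (-(star C * C)) x x = - matrixForm (star C * C) x x := by
        simp [matrixForm, matrixAct, inner_sum]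
      rw [h3, matrixForm_star_mul] at h1
      simpa using h1
    · exact Finset.sum_nonneg fun i _ => inner_self_nonneg_complex _
  have : C = 0 := by
    ext i j v
    have h1 := hform (Pi.single j v)
    rw [Finset.sum_eq_zero_iff_of_nonneg (fun i _ => inner_self_nonneg_complex _)] at h1
    have h2 := inner_self_eq_zero.1 (h1 i (Finset.mem_univ i))
    rw [matrixAct, Finset.sum_eq_single j (by intro k _ hk; simp [hk]) (by simp)] at h2
    simpa using h2
  exact hC0 this

omit [CompleteSpace H] in
theorem continuous_sigmaWeak_tsum {φ ψ : ℕ → H} (hφ : Summable fun n => ‖φ n‖ ^ 2)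
    (hψ : Summable fun n => ‖ψ n‖ ^ 2) :
    Continuous[sigmaWeak H, inferInstance] fun A : H →L[ℂ] H => ∑' n, ⟪φ n, A (ψ n)⟫_ℂ :=
  continuous_iInf_dom (i := ⟨(φ, ψ), hφ, hψ⟩) continuous_induced_dom

omit [CompleteSpace H] in
/-- The functional of a trace class operator given by families over an arbitrary index set is
`σ`-weakly continuous. -/
theorem continuous_sigmaWeak_tsum' {ι : Type*} {φ ψ : ι → H} (hφ : Summable fun n => ‖φ n‖ ^ 2)
    (hψ : Summable fun n => ‖ψ n‖ ^ 2) :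
    Continuous[sigmaWeak H, inferInstance] fun A : H →L[ℂ] H => ∑' n, ⟪φ n, A (ψ n)⟫_ℂ := by
  -- A term with `φ n = 0` contributes nothing, and a square summable `φ` has countable support. So
  -- the families are transported to `ℕ` along an injection of that support and padded by zero.
  set S : Set ι := Function.support fun n => ‖φ n‖ ^ 2
  have hS : Countable S := hφ.countable_support
  obtain ⟨e, he⟩ := exists_injective_nat S
  have hext : ∀ χ : ι → H, Summable (fun n => ‖χ n‖ ^ 2) →
      Summable fun n => ‖Function.extend e (fun s : S => χ s) 0 n‖ ^ 2 := by
    intro χ hχ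
    have : (fun n => ‖Function.extend e (fun s : S => χ s) 0 n‖ ^ 2)
        = Function.extend e (fun s : S => ‖χ s‖ ^ 2) 0 := by
      funext n
      by_cases hn : ∃ s, e s = n
      · obtain ⟨s, rfl⟩ := hn
        simp [he.extend_apply]
      · simp [Function.extend_apply' _ _ _ hn]
    rw [this, summable_extend_zero he]
    exact hχ.subtype S
  convert continuous_sigmaWeak_tsum (hext φ hφ) (hext ψ hψ) using 1
  funext A
  have h1 : (fun n => ⟪Function.extend e (fun s : S => φ s) 0 n,
      A (Function.extend e (fun s : S => ψ s) 0 n)⟫_ℂ)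
      = Function.extend e (fun s : S => ⟪φ s, A (ψ s)⟫_ℂ) 0 := by
    funext n
    by_cases hn : ∃ s, e s = n
    · obtain ⟨s, rfl⟩ := hn
      simp [he.extend_apply]
    · simp [Function.extend_apply' _ _ _ hn]
  rw [h1, tsum_extend_zero he]
  symm
  refine tsum_subtype_eq_of_support_subset (f := fun n => ⟪φ n, A (ψ n)⟫_ℂ) ?_
  intro i hi
  simp only [Function.mem_support, S] at hi ⊢
  contrapose! hi
  simp only [pow_eq_zero_iff two_ne_zero, norm_eq_zero] at hi
  simp [hi]

/-- `Φ` has the Kraus decomposition `Φ A = ∑ₘ Lₘ^* A Lₘ`, the sum converging weakly. -/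
def HasKraus {ι : Type*} (Φ : (H →L[ℂ] H) → (H →L[ℂ] H)) (L : ι → H → H) : Prop :=
  ∀ A φ ψ, HasSum (fun m => ⟪L m φ, A (L m ψ)⟫_ℂ) ⟪φ, Φ A ψ⟫_ℂ

namespace HasKraus

variable {ι : Type*} {Φ : (H →L[ℂ] H) → (H →L[ℂ] H)} {L : ι → H → H}

omit [CompleteSpace H] in
theorem map_add (h : HasKraus Φ L) (A B : H →L[ℂ] H) : Φ (A + B) = Φ A + Φ B := by
  ext ψ
  refine ext_inner_left ℂ fun φ => (h (A + B) φ ψ).unique ?_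
  simpa [inner_add_right] using (h A φ ψ).add (h B φ ψ)

omit [CompleteSpace H] in
theorem map_smul (h : HasKraus Φ L) (c : ℂ) (A : H →L[ℂ] H) : Φ (c • A) = c • Φ A := by
  ext ψ
  refine ext_inner_left ℂ fun φ => (h (c • A) φ ψ).unique ?_
  simpa [inner_smul_right] using (h A φ ψ).mul_left c

theorem map_star (h : HasKraus Φ L) (A : H →L[ℂ] H) : Φ (star A) = star (Φ A) := by
  ext ψ
  refine ext_inner_left ℂ fun φ => (h (star A) φ ψ).unique ?_
  rw [ContinuousLinearMap.star_eq_adjoint, ContinuousLinearMap.star_eq_adjoint,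
    ContinuousLinearMap.adjoint_inner_right, ← inner_conj_symm]
  have h1 := (h A ψ φ).map (starRingEnd ℂ) Complex.continuous_conj
  simpa [Function.comp_def, inner_conj_symm, ContinuousLinearMap.adjoint_inner_right] using h1

/-- Applying `Φ` entrywise to `M` turns its quadratic form at `x` into the sum over `m` of the forms
of `M` at the tuples `L m (x i)`, each of which is nonnegative. -/
theorem exists_completelyPositiveMap (h : HasKraus Φ L) :
    ∃ Ψ : (H →L[ℂ] H) →CP (H →L[ℂ] H), ∀ A, Ψ A = Φ A := by
  refine ⟨⟨⟨⟨Φ, h.map_add⟩, h.map_smul⟩, fun k M hM => ?_⟩, fun A => rfl⟩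
  apply nonneg_of_matrixForm_nonneg
  · have hM' : star M = M := hM.isSelfAdjoint
    refine CStarMatrix.ext fun i j => ?_
    have : star (M j i) = M i j := by rw [← CStarMatrix.star_apply, hM']
    change star (Φ (M j i)) = Φ (M i j)
    rw [← h.map_star, this]
  · intro x
    have hs : HasSum (fun m => matrixForm M (fun i => L m (x i)) (fun i => L m (x i)))
        (matrixForm (CStarMatrix.map M Φ) x x) := by
      simp only [matrixForm, matrixAct, inner_sum]
      exact hasSum_sum fun i _ => hasSum_sum fun j _ => h (M i j) (x i) (x j)
    exact hs.nonneg fun m => matrixForm_self_nonneg hM _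

omit [CompleteSpace H] in
theorem hasSum_norm_sq (h : HasKraus Φ L) (h1 : Φ 1 = 1) (φ : H) :
    HasSum (fun m => ‖L m φ‖ ^ 2) (‖φ‖ ^ 2) := by
  have := h 1 φ φ
  simp only [h1, one_apply_eq_self, inner_self_eq_norm_sq_to_K] at this
  exact_mod_cast this

omit [CompleteSpace H] in
-- The functional attached to `(φ n)`, `(ψ n)` pulls back to the one attached to `L m (φ n)`, `L m
-- (ψ n)`. These doubly indexed families are square summable because `Φ 1 = 1` forces `∑ₘ ‖L m φ‖² =
-- ‖φ‖²`.
theorem continuous (h : HasKraus Φ L) (h1 : Φ 1 = 1) :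
    Continuous[sigmaWeak H, sigmaWeak H] Φ := by
  refine continuous_iInf_rng.2 fun ⟨⟨φ, ψ⟩, hφ, hψ⟩ => continuous_induced_rng.2 ?_
  have hsum : ∀ χ : ℕ → H, Summable (fun n => ‖χ n‖ ^ 2) →
      Summable fun p : ℕ × ι => ‖L p.2 (χ p.1)‖ ^ 2 := by
    intro χ hχ
    rw [summable_prod_of_nonneg (fun _ => sq_nonneg _)]
    exact ⟨fun n => (h.hasSum_norm_sq h1 (χ n)).summable,
      by simpa [(h.hasSum_norm_sq h1 _).tsum_eq] using hχ⟩
  convert continuous_sigmaWeak_tsum' (hsum φ hφ) (hsum ψ hψ) using 1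
  funext A
  have hs : Summable fun p : ℕ × ι => ⟪L p.2 (φ p.1), A (L p.2 (ψ p.1))⟫_ℂ := by
    refine Summable.of_norm_bounded
      (((hsum φ hφ).add (hsum ψ hψ)).mul_left ‖A‖) fun p => ?_
    have h2 := norm_inner_le_norm (𝕜 := ℂ) (L p.2 (φ p.1)) (A (L p.2 (ψ p.1)))
    have h3 := A.le_opNorm (L p.2 (ψ p.1))
    have h4 : ‖L p.2 (φ p.1)‖ * ‖A (L p.2 (ψ p.1))‖
        ≤ ‖L p.2 (φ p.1)‖ * (‖A‖ * ‖L p.2 (ψ p.1)‖) := by gcongr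
    have h5 : ‖L p.2 (φ p.1)‖ * ‖L p.2 (ψ p.1)‖
        ≤ ‖L p.2 (φ p.1)‖ ^ 2 + ‖L p.2 (ψ p.1)‖ ^ 2 := by
      nlinarith [sq_nonneg (‖L p.2 (φ p.1)‖ - ‖L p.2 (ψ p.1)‖), sq_nonneg ‖L p.2 (φ p.1)‖,
        sq_nonneg ‖L p.2 (ψ p.1)‖]
    have h6 := mul_le_mul_of_nonneg_left h5 (norm_nonneg A)
    linarith
  rw [hs.tsum_prod]
  exact tsum_congr fun n => ((h A (φ n) (ψ n)).tsum_eq).symm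

end HasKraus

end KrausMaps

/-! ### Tensor products of `L²` spaces, slices and partial traces -/

/-- Parseval's identity for a complete orthogonal family of isometries. -/
theorem hasSum_inner_adjoint {ι G E : Type*} [NormedAddCommGroup G] [InnerProductSpace ℂ G]
    [CompleteSpace G] [NormedAddCommGroup E] [InnerProductSpace ℂ E] [CompleteSpace E]
    (T : ι → G →L[ℂ] E) (hT : ∀ i x y, ⟪T i x, T i y⟫_ℂ = ⟪x, y⟫_ℂ)
    (hTT : ∀ i j, i ≠ j → ∀ x y, ⟪T i x, T j y⟫_ℂ = 0)
    (htot : ∀ u, (∀ i x, ⟪T i x, u⟫_ℂ = 0) → u = 0) (u v : E) :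
    HasSum (fun i => ⟪(T i).adjoint u, (T i).adjoint v⟫_ℂ) ⟪u, v⟫_ℂ := by
  classical
  let V : ι → G →ₗᵢ[ℂ] E := fun i => (T i).toLinearMap.isometryOfInner (hT i)
  have hV : IsHilbertSum ℂ (fun _ : ι => G) V := by
    refine IsHilbertSum.mk (fun i j hij x y => hTT i j hij x y) ?_
    rw [top_le_iff, Submodule.topologicalClosure_eq_top_iff, Submodule.eq_bot_iff]
    intro u hu
    refine htot u fun i x => ?_
    exact (Submodule.mem_orthogonal _ _).1 hu _
      (Submodule.mem_iSup_of_mem i (LinearMap.mem_range_self _ x))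
  -- The `i`-th coordinate in the Hilbert sum is `T i` adjoint, so Parseval for the sum is the
  -- claim.
  have hcoord : ∀ w i, hV.linearIsometryEquiv w i = (T i).adjoint w := by
    intro w i
    refine ext_inner_left ℂ fun x => ?_
    rw [ContinuousLinearMap.adjoint_inner_right]
    refine (lp.inner_single_left (𝕜 := ℂ) (G := fun _ : ι => G) i x
      (hV.linearIsometryEquiv w)).symm.trans ?_
    rw [← hV.linearIsometryEquiv.symm.inner_map_map, hV.linearIsometryEquiv_symm_apply_single]
    simp [V]
  have h1 := lp.hasSum_inner (𝕜 := ℂ) (hV.linearIsometryEquiv u) (hV.linearIsometryEquiv v)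
  rw [LinearIsometryEquiv.inner_map_map] at h1
  refine h1.congr_fun fun i => ?_
  exact (congrArg₂ _ (hcoord u i) (hcoord v i)).symm

section Tensor

variable {α β : Type*} [MeasurableSpace α] [MeasurableSpace β] {μ : Measure α} {ν : Measure β}

theorem coeFn_tensor [SFinite μ] [SFinite ν] (f : Lp ℂ 2 μ) (g : Lp ℂ 2 ν) :
    tensor μ ν f g =ᵐ[μ.prod ν] fun p => f p.1 * g p.2 :=
  (memLp_tensor f g).coeFn_toLp

theorem inner_tensor [SFinite μ] [SFinite ν] (f f' : Lp ℂ 2 μ) (g g' : Lp ℂ 2 ν) :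
    ⟪tensor μ ν f g, tensor μ ν f' g'⟫_ℂ = ⟪f, f'⟫_ℂ * ⟪g, g'⟫_ℂ := by
  rw [L2.inner_def, L2.inner_def, L2.inner_def, ← integral_prod_mul]
  refine integral_congr_ae ?_
  filter_upwards [coeFn_tensor f g, coeFn_tensor f' g'] with p h1 h2
  rw [h1, h2]
  simp only [RCLike.inner_apply, map_mul]
  ring

theorem tensor_indicatorConstLp [SFinite μ] [SFinite ν] {s : Set α} {t : Set β}
    (hs : MeasurableSet s) (ht : MeasurableSet t) (hμs : μ s ≠ ∞) (hνt : ν t ≠ ∞)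
    (hst : μ.prod ν (s ×ˢ t) ≠ ∞) :
    tensor μ ν (indicatorConstLp 2 hs hμs 1) (indicatorConstLp 2 ht hνt 1)
      = indicatorConstLp 2 (hs.prod ht) hst 1 := by
  apply Lp.ext
  filter_upwards [coeFn_tensor (indicatorConstLp 2 hs hμs (1 : ℂ)) (indicatorConstLp 2 ht hνt 1),
    Measure.quasiMeasurePreserving_fst.ae (indicatorConstLp_coeFn (p := 2) (hs := hs) (hμs := hμs)
      (c := (1 : ℂ))),
    Measure.quasiMeasurePreserving_snd.ae (indicatorConstLp_coeFn (p := 2) (hs := ht) (hμs := hνt)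
      (c := (1 : ℂ))),
    indicatorConstLp_coeFn (p := 2) (hs := hs.prod ht) (hμs := hst) (c := (1 : ℂ))]
    with p h1 h2 h3 h4
  rw [h1, h2, h3, h4]
  by_cases h5 : p.1 ∈ s <;> by_cases h6 : p.2 ∈ t <;> simp [h5, h6]

variable [SigmaFinite μ] [SigmaFinite ν]

/-- A vector orthogonal to all product vectors vanishes. -/
theorem eq_zero_of_inner_tensor {h : Lp ℂ 2 (μ.prod ν)}
    (hh : ∀ f g, ⟪tensor μ ν f g, h⟫_ℂ = 0) : h = 0 := by
  -- An `L²` function is integrable only on sets of finite measure, so the vanishing is proved on an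
  -- exhaustion by finite rectangles.
  let F : ℕ → Set (α × β) := fun n => spanningSets μ n ×ˢ spanningSets ν n
  have hFm : ∀ n, MeasurableSet (F n) := fun n =>
    (measurableSet_spanningSets μ n).prod (measurableSet_spanningSets ν n)
  have hFfin : ∀ n, μ.prod ν (F n) ≠ ∞ := fun n => by
    rw [Measure.prod_prod]
    exact (ENNReal.mul_lt_top (measure_spanningSets_lt_top μ n)
      (measure_spanningSets_lt_top ν n)).ne
  have hrect : ∀ (s : Set α) (t : Set β), MeasurableSet s → MeasurableSet t → μ s ≠ ∞ → ν t ≠ ∞ →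
      ∫ p in s ×ˢ t, h p ∂(μ.prod ν) = 0 := by
    intro s t hs ht hμs hνt
    have hst : μ.prod ν (s ×ˢ t) ≠ ∞ := by
      rw [Measure.prod_prod]; exact ENNReal.mul_ne_top hμs hνt
    rw [← L2.inner_indicatorConstLp_one (𝕜 := ℂ) (hs.prod ht) hst,
      ← tensor_indicatorConstLp hs ht hμs hνt hst, hh]
  have hF : ∀ n, ∀ᵐ p ∂(μ.prod ν), p ∈ F n → h p = 0 := by
    intro n
    have hint : IntegrableOn h (F n) (μ.prod ν) :=
      integrableOn_Lp_of_measure_ne_top h (by norm_num) (hFfin n)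
    rw [← ae_restrict_iff' (hFm n)]
    -- The integral vanishes on rectangles by orthogonality to products of indicators. The π-λ
    -- theorem extends this to all measurable sets.
    have key : ∀ s, MeasurableSet s → ∫ p in s, h p ∂((μ.prod ν).restrict (F n)) = 0 := by
      have huniv : ∫ p, h p ∂((μ.prod ν).restrict (F n)) = 0 :=
        hrect _ _ (measurableSet_spanningSets μ n) (measurableSet_spanningSets ν n)
          (measure_spanningSets_lt_top μ n).ne (measure_spanningSets_lt_top ν n).ne
      intro s hs
      induction s, hs using MeasurableSpace.induction_on_inter generateFrom_prod.symm
        isPiSystem_prod with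
      | empty => simp
      | basic s hs =>
        obtain ⟨a, ha, b, hb, rfl⟩ := hs
        have ha : MeasurableSet a := ha
        have hb : MeasurableSet b := hb
        rw [Measure.restrict_restrict (ha.prod hb), Set.prod_inter_prod]
        exact hrect _ _ (ha.inter (measurableSet_spanningSets μ n))
          (hb.inter (measurableSet_spanningSets ν n))
          ((measure_mono Set.inter_subset_right).trans_lt (measure_spanningSets_lt_top μ n)).ne
          ((measure_mono Set.inter_subset_right).trans_lt (measure_spanningSets_lt_top ν n)).ne
      | compl s hs ih => rw [setIntegral_compl hs hint, huniv, ih, sub_zero]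
      | iUnion f hd hf ih =>
        rw [integral_iUnion hf hd hint.integrableOn]
        simp [ih]
    exact Integrable.ae_eq_zero_of_forall_setIntegral_eq_zero hint fun s hs _ => key s hs
  apply Lp.ext
  filter_upwards [ae_all_iff.2 hF, Lp.coeFn_zero ℂ 2 (μ.prod ν)] with p hp h0
  rw [h0]
  obtain ⟨n, hn⟩ := Set.mem_iUnion.1
    ((iUnion_spanningSets μ).symm ▸ Set.mem_univ p.1 : p.1 ∈ ⋃ n, spanningSets μ n)
  obtain ⟨m, hm⟩ := Set.mem_iUnion.1
    ((iUnion_spanningSets ν).symm ▸ Set.mem_univ p.2 : p.2 ∈ ⋃ n, spanningSets ν n)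
  exact hp (max n m) ⟨monotone_spanningSets μ (le_max_left n m) hn,
    monotone_spanningSets ν (le_max_right n m) hm⟩

theorem denseRange_tensorIncl : DenseRange (tensorIncl μ ν) := by
  have h : (LinearMap.range (tensorIncl μ ν)).topologicalClosure = ⊤ := by
    rw [Submodule.topologicalClosure_eq_top_iff, Submodule.eq_bot_iff]
    intro u hu
    refine eq_zero_of_inner_tensor fun f g => ?_
    exact (Submodule.mem_orthogonal _ _).1 hu _ ⟨f ⊗ₜ g, by simp [tensorIncl]⟩
  exact (Submodule.dense_iff_topologicalClosure_eq_top.2 h)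

/-- Bounded operators on `L²(μ ⊗ ν)` are determined by their values on product vectors. -/
theorem ext_tensor {F : Type*} [NormedAddCommGroup F] [NormedSpace ℂ F]
    {S T : Lp ℂ 2 (μ.prod ν) →L[ℂ] F} (h : ∀ f g, S (tensor μ ν f g) = T (tensor μ ν f g)) :
    S = T := by
  have h1 : S.toLinearMap ∘ₗ tensorIncl μ ν = T.toLinearMap ∘ₗ tensorIncl μ ν :=
    TensorProduct.ext' fun f g => by simpa [tensorIncl] using h f g
  refine DFunLike.coe_injective
    (denseRange_tensorIncl.equalizer S.continuous T.continuous ?_)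
  funext t
  exact LinearMap.congr_fun h1 t

/-- The adjoint of `x ↦ x ⊗ χ` is thus the slice map: the partial inner product with `χ` in the
second factor. -/
theorem adjoint_tensor_flip_tensor (χ : Lp ℂ 2 ν) (f : Lp ℂ 2 μ) (g : Lp ℂ 2 ν) :
    ((tensor μ ν).flip χ).adjoint (tensor μ ν f g) = ⟪χ, g⟫_ℂ • f := by
  refine ext_inner_left ℂ fun x => ?_
  rw [ContinuousLinearMap.adjoint_inner_right, ContinuousLinearMap.flip_apply, inner_tensor,
    inner_smul_right, mul_comm]

theorem adjoint_tensor_tensor (a f : Lp ℂ 2 μ) (g : Lp ℂ 2 ν) :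
    (tensor μ ν a).adjoint (tensor μ ν f g) = ⟪a, f⟫_ℂ • g := by
  refine ext_inner_left ℂ fun x => ?_
  rw [ContinuousLinearMap.adjoint_inner_right, inner_tensor, inner_smul_right]

/-- Parseval's identity for the slices along an orthonormal basis of the second factor. -/
theorem hasSum_inner_adjoint_tensor_flip {ι : Type*} (b : HilbertBasis ι ℂ (Lp ℂ 2 ν))
    (u v : Lp ℂ 2 (μ.prod ν)) :
    HasSum (fun i => ⟪((tensor μ ν).flip (b i)).adjoint u, ((tensor μ ν).flip (b i)).adjoint v⟫_ℂ)
      ⟪u, v⟫_ℂ := by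
  classical
  refine hasSum_inner_adjoint (fun i => (tensor μ ν).flip (b i)) (fun i x y => ?_)
    (fun i j hij x y => ?_) (fun w hw => ?_) u v
  · simp [inner_tensor, b.orthonormal.1 i]
  · simp [inner_tensor, b.orthonormal.inner_eq_zero hij]
  · refine eq_zero_of_inner_tensor fun f g => ?_
    have h1 : (tensor μ ν f).adjoint w = 0 := by
      apply b.repr.injective
      ext i
      rw [b.repr_apply_apply, ContinuousLinearMap.adjoint_inner_right]
      simpa using hw i f
    rw [← ContinuousLinearMap.adjoint_inner_right, h1, inner_zero_right]

/-- Parseval's identity for the slices along an orthonormal basis of the first factor. -/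
theorem hasSum_inner_adjoint_tensor {ι : Type*} (b : HilbertBasis ι ℂ (Lp ℂ 2 μ))
    (u v : Lp ℂ 2 (μ.prod ν)) :
    HasSum (fun i => ⟪(tensor μ ν (b i)).adjoint u, (tensor μ ν (b i)).adjoint v⟫_ℂ)
      ⟪u, v⟫_ℂ := by
  classical
  refine hasSum_inner_adjoint (fun i => tensor μ ν (b i)) (fun i x y => ?_)
    (fun i j hij x y => ?_) (fun w hw => ?_) u v
  · simp [inner_tensor, b.orthonormal.1 i]
  · simp [inner_tensor, b.orthonormal.inner_eq_zero hij]
  · refine eq_zero_of_inner_tensor fun f g => ?_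
    have h1 : ((tensor μ ν).flip g).adjoint w = 0 := by
      apply b.repr.injective
      ext i
      rw [b.repr_apply_apply, ContinuousLinearMap.adjoint_inner_right]
      simpa using hw i g
    rw [← ContinuousLinearMap.flip_apply (tensor μ ν), ← ContinuousLinearMap.adjoint_inner_right,
      h1, inner_zero_right]

/-- The extension by continuity has the expected values only once the algebraic map is known to be
bounded. Slices in the second factor intertwine `A ⊗ 1` with `A`, so Parseval over the slices gives
the bound `‖A‖`. -/
theorem tensorOp_one_right_tensor (A : Lp ℂ 2 μ →L[ℂ] Lp ℂ 2 μ) (f : Lp ℂ 2 μ) (g : Lp ℂ 2 ν) :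
    tensorOp μ ν A 1 (tensor μ ν f g) = tensor μ ν (A f) g := by
  set X := TensorProduct.map (A : Lp ℂ 2 μ →ₗ[ℂ] Lp ℂ 2 μ)
    ((1 : Lp ℂ 2 ν →L[ℂ] Lp ℂ 2 ν) : Lp ℂ 2 ν →ₗ[ℂ] Lp ℂ 2 ν)
  obtain ⟨w, b, -⟩ := exists_hilbertBasis ℂ (Lp ℂ 2 ν)
  have hslice : ∀ χ t, ((tensor μ ν).flip χ).adjoint (tensorIncl μ ν (X t))
      = A (((tensor μ ν).flip χ).adjoint (tensorIncl μ ν t)) := by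
    intro χ t
    induction t with
    | zero => simp
    | tmul x y => simp [X, tensorIncl, adjoint_tensor_flip_tensor]
    | add x y hx hy => simp only [map_add, hx, hy]
  have hbound : ∀ t, ‖tensorIncl μ ν (X t)‖ ≤ ‖A‖ * ‖tensorIncl μ ν t‖ := by
    intro t
    have hP : ∀ u : Lp ℂ 2 (μ.prod ν),
        HasSum (fun i => ‖((tensor μ ν).flip (b i)).adjoint u‖ ^ 2) (‖u‖ ^ 2) := by
      intro u
      have := hasSum_inner_adjoint_tensor_flip (μ := μ) b u u
      simp only [inner_self_eq_norm_sq_to_K] at this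
      exact_mod_cast this
    have h1 : ‖tensorIncl μ ν (X t)‖ ^ 2 ≤ ‖A‖ ^ 2 * ‖tensorIncl μ ν t‖ ^ 2 := by
      refine hasSum_le (fun i => ?_) (hP _) ((hP (tensorIncl μ ν t)).mul_left (‖A‖ ^ 2))
      rw [hslice, ← mul_pow]
      gcongr
      exact A.le_opNorm _
    rw [← mul_pow] at h1
    exact le_of_sq_le_sq h1 (by positivity)
  have := LinearMap.extendOfNorm_eq (f := tensorIncl μ ν ∘ₗ X) (e := tensorIncl μ ν)
    denseRange_tensorIncl ⟨‖A‖, hbound⟩ (f ⊗ₜ g)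
  simpa [tensorIncl, X, tensorOp] using this

theorem adjoint_tensor_flip_tensorOp (A : Lp ℂ 2 μ →L[ℂ] Lp ℂ 2 μ) (χ : Lp ℂ 2 ν)
    (u : Lp ℂ 2 (μ.prod ν)) :
    ((tensor μ ν).flip χ).adjoint (tensorOp μ ν A 1 u)
      = A (((tensor μ ν).flip χ).adjoint u) := by
  have : ((tensor μ ν).flip χ).adjoint ∘L tensorOp μ ν A 1
      = A ∘L ((tensor μ ν).flip χ).adjoint :=
    ext_tensor fun f g => by simp [tensorOp_one_right_tensor, adjoint_tensor_flip_tensor]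
  exact congr($this u)

theorem adjoint_tensor_tensorOp (A : Lp ℂ 2 μ →L[ℂ] Lp ℂ 2 μ) (a : Lp ℂ 2 μ)
    (u : Lp ℂ 2 (μ.prod ν)) :
    (tensor μ ν a).adjoint (tensorOp μ ν A 1 u) = (tensor μ ν (A.adjoint a)).adjoint u := by
  have : (tensor μ ν a).adjoint ∘L tensorOp μ ν A 1 = (tensor μ ν (A.adjoint a)).adjoint :=
    ext_tensor fun f g => by
      simp [tensorOp_one_right_tensor, adjoint_tensor_tensor,
        ContinuousLinearMap.adjoint_inner_left]
  exact congr($this u)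

theorem tensorOp_one_one : tensorOp μ ν 1 1 = 1 :=
  ext_tensor fun f g => by simp [tensorOp_one_right_tensor]

/-- Kraus decomposition of the map `A ↦ Tr_{|χ⟩⟨χ|}[V^* (A ⊗ I) V]`. -/
theorem hasKraus_partialTrace (χ : Lp ℂ 2 ν) (V : Lp ℂ 2 (μ.prod ν) →L[ℂ] Lp ℂ 2 (μ.prod ν))
    {ι : Type*} (b : HilbertBasis ι ℂ (Lp ℂ 2 ν)) :
    HasKraus (fun A => partialTrace μ ν χ (V.adjoint ∘L tensorOp μ ν A 1 ∘L V))
      (fun i φ => ((tensor μ ν).flip (b i)).adjoint (V (tensor μ ν φ χ))) := by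
  intro A φ ψ
  rw [inner_partialTrace, ContinuousLinearMap.comp_apply, ContinuousLinearMap.comp_apply,
    ContinuousLinearMap.adjoint_inner_right]
  refine (hasSum_inner_adjoint_tensor_flip b _ _).congr_fun fun i => ?_
  rw [adjoint_tensor_flip_tensorOp]

theorem partialTrace_one {χ : Lp ℂ 2 ν} (hχ : ‖χ‖ = 1)
    {V : Lp ℂ 2 (μ.prod ν) →L[ℂ] Lp ℂ 2 (μ.prod ν)} (hV : V.adjoint ∘L V = 1) :
    partialTrace μ ν χ (V.adjoint ∘L tensorOp μ ν 1 1 ∘L V) = 1 := by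
  ext1 ψ
  refine ext_inner_left ℂ fun φ => ?_
  have : V.adjoint ∘L (1 : Lp ℂ 2 (μ.prod ν) →L[ℂ] Lp ℂ 2 (μ.prod ν)) ∘L V = 1 := hV
  rw [inner_partialTrace, tensorOp_one_one, this]
  simp [inner_tensor, hχ, inner_self_eq_norm_sq_to_K]

end Tensor

/-! ### Composition operators -/

section Koopman

variable {α β : Type*} [MeasurableSpace α] [MeasurableSpace β] {μ : Measure α} {ν : Measure β}

theorem koopman_of_measurePreserving {T : α → α} (hT : MeasurePreserving T μ μ) :
    koopman μ T = (Lp.compMeasurePreservingₗᵢ ℂ T hT).toContinuousLinearMap := by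
  simp [koopman, hT]

theorem coeFn_koopman {T : α → α} (hT : MeasurePreserving T μ μ) (f : Lp ℂ 2 μ) :
    koopman μ T f =ᵐ[μ] f ∘ T := by
  rw [koopman_of_measurePreserving hT]
  exact Lp.coeFn_compMeasurePreserving f hT

theorem inner_koopman_koopman {T : α → α} (hT : MeasurePreserving T μ μ) (f g : Lp ℂ 2 μ) :
    ⟪koopman μ T f, koopman μ T g⟫_ℂ = ⟪f, g⟫_ℂ := by
  rw [koopman_of_measurePreserving hT]
  exact LinearIsometry.inner_map_map _ f g

theorem koopman_koopman {S T : α → α} (hS : MeasurePreserving S μ μ)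
    (hT : MeasurePreserving T μ μ) (f : Lp ℂ 2 μ) :
    koopman μ S (koopman μ T f) = koopman μ (T ∘ S) f := by
  apply Lp.ext
  filter_upwards [coeFn_koopman hS (koopman μ T f), coeFn_koopman (hT.comp hS) f,
    hS.quasiMeasurePreserving.ae (coeFn_koopman hT f)] with x h1 h2 h3
  rw [h1, h2, Function.comp_apply, h3]
  rfl

theorem koopman_id (f : Lp ℂ 2 μ) : koopman μ id f = f :=
  Lp.ext (coeFn_koopman (MeasurePreserving.id μ) f)

theorem adjoint_koopman {S T : α → α} (hS : MeasurePreserving S μ μ)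
    (hT : MeasurePreserving T μ μ) (hST : S ∘ T = id) :
    (koopman μ S).adjoint = koopman μ T := by
  symm
  rw [ContinuousLinearMap.eq_adjoint_iff]
  intro f g
  rw [← inner_koopman_koopman hT f, koopman_koopman hT hS, hST, koopman_id]

theorem adjoint_koopman_comp_koopman {T : α → α} (hT : MeasurePreserving T μ μ) :
    (koopman μ T).adjoint ∘L koopman μ T = 1 := by
  ext1 f
  refine ext_inner_left ℂ fun g => ?_
  rw [ContinuousLinearMap.comp_apply, ContinuousLinearMap.adjoint_inner_right,
    inner_koopman_koopman hT]
  rfl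

theorem tensorOp_one_koopman [SigmaFinite μ] [SigmaFinite ν] {T : β → β}
    (hT : MeasurePreserving T ν ν) :
    tensorOp μ ν 1 (koopman ν T) = koopman (μ.prod ν) (Prod.map id T) := by
  have hT' : MeasurePreserving (Prod.map id T) (μ.prod ν) (μ.prod ν) :=
    (MeasurePreserving.id μ).prod hT
  have hcomp : (koopman (μ.prod ν) (Prod.map id T)).toLinearMap ∘ₗ tensorIncl μ ν
      = tensorIncl μ ν ∘ₗ TensorProduct.map
        ((1 : Lp ℂ 2 μ →L[ℂ] Lp ℂ 2 μ) : Lp ℂ 2 μ →ₗ[ℂ] Lp ℂ 2 μ)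
        (koopman ν T : Lp ℂ 2 ν →ₗ[ℂ] Lp ℂ 2 ν) := by
    refine TensorProduct.ext' fun f g => ?_
    have : koopman (μ.prod ν) (Prod.map id T) (tensor μ ν f g) = tensor μ ν f (koopman ν T g) := by
      apply Lp.ext
      filter_upwards [coeFn_koopman hT' (tensor μ ν f g), coeFn_tensor f (koopman ν T g),
        hT'.quasiMeasurePreserving.ae (coeFn_tensor f g),
        Measure.quasiMeasurePreserving_snd.ae (coeFn_koopman hT g)] with p h1 h2 h3 h4
      rw [h1, h2, Function.comp_apply, h3, h4]
      rfl
    simpa [tensorIncl] using this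
  -- The composition operator on the product agrees with `1 ⊗ koopman ν T` on algebraic tensors.
  -- Being isometric, it also supplies the bound `1`.
  refine LinearMap.extendOfNorm_unique denseRange_tensorIncl 1 (fun t => ?_) _ hcomp
  rw [← hcomp, one_mul]
  have h1 := inner_koopman_koopman hT' (tensorIncl μ ν t) (tensorIncl μ ν t)
  simp only [inner_self_eq_norm_sq_to_K] at h1
  have h2 : ‖koopman (μ.prod ν) (Prod.map id T) (tensorIncl μ ν t)‖ ^ 2
      = ‖tensorIncl μ ν t‖ ^ 2 := by exact_mod_cast h1
  exact ((sq_eq_sq₀ (norm_nonneg _) (norm_nonneg _)).1 h2).le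

end Koopman

/-! ### Increments of the two-sided process and invariance under the shifts -/

section Increments

variable {d : ℕ} {Q : Measure (ℝ≥0 → EuclideanSpace ℝ (Fin d))} [IsProbabilityMeasure Q]

theorem IsLevyProcess.map_sub (hQ : IsLevyProcess (fun (t : ℝ≥0) w => w t) Q) {s t : ℝ≥0}
    (hst : s ≤ t) : Q.map (fun w => w t - w s) = Q.map (fun w => w (t - s)) :=
  (hQ.stationary s t hst).map_eq

theorem IsLevyProcess.map_zero (hQ : IsLevyProcess (fun (t : ℝ≥0) w => w t) Q) :
    Q.map (fun w => w 0) = Measure.dirac 0 := by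
  rw [Measure.map_congr (g := fun _ => 0) hQ.zero]
  simp

theorem IsLevyProcess.map_add (hQ : IsLevyProcess (fun (t : ℝ≥0) w => w t) Q) (s t : ℝ≥0) :
    Q.map (fun w => w (s + t)) = Q.map (fun w => w t) ∗ Q.map (fun w => w s) := by
  have hψ : Measurable fun x : Set.Iic s → EuclideanSpace ℝ (Fin d) =>
      x ⟨s, Set.mem_Iic.2 le_rfl⟩ := by fun_prop
  have hind : IndepFun (fun w => w (s + t) - w s) (fun w : ℝ≥0 → EuclideanSpace ℝ (Fin d) => w s)
      Q := (hQ.indep s (s + t) le_self_add).comp measurable_id hψ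
  have h1 := hind.map_add_eq_map_conv_map (by fun_prop) (by fun_prop)
  rw [hQ.map_sub le_self_add, add_tsub_cancel_left] at h1
  rw [← h1]
  congr 1
  funext w
  simp

/-- The increments of a Lévy process over a family of consecutive intervals are independent. -/
theorem IsLevyProcess.iIndepFun_increments (hQ : IsLevyProcess (fun (t : ℝ≥0) w => w t) Q)
    {ι : Type*} [LinearOrder ι] {a b : ι → ℝ≥0} (hab : ∀ i, a i ≤ b i)
    (hba : ∀ i j, i < j → b i ≤ a j) :
    iIndepFun (fun i w => w (b i) - w (a i)) Q := by
  rw [iIndepFun_iff_measure_inter_preimage_eq_mul]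
  intro S
  induction S using Finset.induction_on_max with
  | empty => simp
  | insert m S hm ih =>
    intro sets hsets
    have hmS : m ∉ S := fun h => lt_irrefl _ (hm m h)
    rw [Finset.set_biInter_insert, Finset.prod_insert hmS,
      ← ih fun i hi => hsets i (Finset.mem_insert_of_mem hi)]
    -- All increments indexed below `m` are functions of the path up to time `a m`, so the last
    -- increment is independent of them jointly.
    have hpast : (⋂ i ∈ S, (fun w : ℝ≥0 → EuclideanSpace ℝ (Fin d) => w (b i) - w (a i)) ⁻¹' sets i)
        = (fun w (u : Set.Iic (a m)) => w u) ⁻¹' (⋂ i : {i // i ∈ S},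
          (fun x : Set.Iic (a m) → EuclideanSpace ℝ (Fin d) =>
            x ⟨b i, hba _ _ (hm i i.2)⟩ - x ⟨a i, (hab i).trans (hba _ _ (hm i i.2))⟩) ⁻¹'
              sets i) := by
      ext w; simp
    rw [hpast]
    refine (hQ.indep (a m) (b m) (hab m)).measure_inter_preimage_eq_mul _ _
      (hsets m (Finset.mem_insert_self _ _)) ?_
    refine MeasurableSet.iInter fun i => ?_
    have hi : Measurable fun x : Set.Iic (a m) → EuclideanSpace ℝ (Fin d) =>
        x ⟨b i, hba _ _ (hm i i.2)⟩ - x ⟨a i, (hab i).trans (hba _ _ (hm i i.2))⟩ := by fun_prop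
    exact hi (hsets i (Finset.mem_insert_of_mem i.2))

theorem glue_sub_of_nonneg (p : (ℝ≥0 → EuclideanSpace ℝ (Fin d)) × (ℝ≥0 → EuclideanSpace ℝ (Fin d)))
    {s t : ℝ} (hs : 0 ≤ s) (hst : s ≤ t) :
    (glue p).1 t - (glue p).1 s = p.1 t.toNNReal - p.1 s.toNNReal := by
  simp [glue, Real.toNNReal_of_nonpos (neg_nonpos.2 hs),
    Real.toNNReal_of_nonpos (neg_nonpos.2 (hs.trans hst))]

theorem glue_sub_of_nonpos (p : (ℝ≥0 → EuclideanSpace ℝ (Fin d)) × (ℝ≥0 → EuclideanSpace ℝ (Fin d)))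
    {s t : ℝ} (ht : t ≤ 0) (hst : s ≤ t) :
    (glue p).1 t - (glue p).1 s = p.2 (-s).toNNReal - p.2 (-t).toNNReal := by
  simp [glue, Real.toNNReal_of_nonpos ht, Real.toNNReal_of_nonpos (hst.trans ht)]

theorem toNNReal_sub_toNNReal {s t : ℝ} (hs : 0 ≤ s) :
    t.toNNReal - s.toNNReal = (t - s).toNNReal := by
  rw [NNReal.sub_def, Real.coe_toNNReal s hs]
  rcases le_total 0 t with ht | ht
  · rw [Real.coe_toNNReal t ht]
  · rw [Real.coe_toNNReal', max_eq_right ht, Real.toNNReal_of_nonpos (by linarith),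
      Real.toNNReal_of_nonpos (by linarith)]

/-- The law of an increment of the two-sided process over an interval not containing `0` in its
interior. -/
theorem IsLevyProcess.map_twoSided_sub (hQ : IsLevyProcess (fun (t : ℝ≥0) w => w t) Q) {s t : ℝ}
    (hst : s ≤ t) (h0 : 0 ≤ s ∨ t ≤ 0) :
    (twoSided Q).map (fun w => w.1 t - w.1 s) = Q.map (fun w => w (t - s).toNNReal) := by
  rw [twoSided, Measure.map_map (by fun_prop) measurable_glue]
  rcases h0 with h0 | h0
  · have : (fun w : PathSpace d => w.1 t - w.1 s) ∘ glue
        = (fun w => w t.toNNReal - w s.toNNReal) ∘ Prod.fst := by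
      funext p; exact glue_sub_of_nonneg p h0 hst
    rw [this, ← Measure.map_map (by fun_prop) measurable_fst, Measure.map_fst_prod, measure_univ,
      one_smul, hQ.map_sub (Real.toNNReal_mono hst), toNNReal_sub_toNNReal h0]
  · have : (fun w : PathSpace d => w.1 t - w.1 s) ∘ glue
        = (fun w => w (-s).toNNReal - w (-t).toNNReal) ∘ Prod.snd := by
      funext p; exact glue_sub_of_nonpos p h0 hst
    rw [this, ← Measure.map_map (by fun_prop) measurable_snd, Measure.map_snd_prod, measure_univ,
      one_smul, hQ.map_sub (Real.toNNReal_mono (neg_le_neg hst)),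
      toNNReal_sub_toNNReal (neg_nonneg.2 h0), neg_sub_neg]

/-- The increments of the two-sided process over a family of consecutive intervals, none of which
contains `0` in its interior, are independent. -/
theorem IsLevyProcess.iIndepFun_twoSided (hQ : IsLevyProcess (fun (t : ℝ≥0) w => w t) Q)
    {ι : Type*} [LinearOrder ι] {a b : ι → ℝ} (hab : ∀ i, a i ≤ b i)
    (hba : ∀ i j, i < j → b i ≤ a j) (h0 : ∀ i, 0 ≤ a i ∨ b i ≤ 0) :
    iIndepFun (fun i (w : PathSpace d) => w.1 (b i) - w.1 (a i)) (twoSided Q) := by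
  classical
  have hpos := hQ.iIndepFun_increments (a := fun i => (a i).toNNReal)
    (b := fun i => (b i).toNNReal) (fun i => Real.toNNReal_mono (hab i))
    (fun i j hij => Real.toNNReal_mono (hba i j hij))
  -- On the negative side time runs backwards: the reflected intervals come in reverse order, hence
  -- the order dual.
  have hneg' := hQ.iIndepFun_increments (ι := ιᵒᵈ)
    (a := fun i => (-(b (OrderDual.ofDual i))).toNNReal)
    (b := fun i => (-(a (OrderDual.ofDual i))).toNNReal)
    (fun i => Real.toNNReal_mono (neg_le_neg (hab _)))
    (fun i j hij => Real.toNNReal_mono (neg_le_neg (hba _ _ hij)))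
  have hneg : iIndepFun (fun (i : ι) (w : ℝ≥0 → EuclideanSpace ℝ (Fin d)) =>
      w (-(a i)).toNNReal - w (-(b i)).toNNReal) Q :=
    hneg'.precomp (g := OrderDual.toDual) OrderDual.toDual.injective
  rw [iIndepFun_iff_measure_inter_preimage_eq_mul] at hpos hneg ⊢
  intro S sets hsets
  have hmeas : ∀ i ∈ S, MeasurableSet
      ((fun w : PathSpace d => w.1 (b i) - w.1 (a i)) ⁻¹' sets i) := fun i hi =>
    (show Measurable fun w : PathSpace d => w.1 (b i) - w.1 (a i) by fun_prop) (hsets i hi)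
  have hone : ∀ i ∈ S, twoSided Q ((fun w : PathSpace d => w.1 (b i) - w.1 (a i)) ⁻¹' sets i)
      = if 0 ≤ a i then Q ((fun w => w (b i).toNNReal - w (a i).toNNReal) ⁻¹' sets i)
        else Q ((fun w => w (-(a i)).toNNReal - w (-(b i)).toNNReal) ⁻¹' sets i) := by
    intro i hi
    rw [← Measure.map_apply (by fun_prop) (hsets i hi), hQ.map_twoSided_sub (hab i) (h0 i)]
    split_ifs with h
    · rw [← Measure.map_apply (by fun_prop) (hsets i hi), hQ.map_sub (Real.toNNReal_mono (hab i)),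
        toNNReal_sub_toNNReal h]
    · rw [← Measure.map_apply (by fun_prop) (hsets i hi),
        hQ.map_sub (Real.toNNReal_mono (neg_le_neg (hab i))),
        toNNReal_sub_toNNReal (neg_nonneg.2 ((h0 i).resolve_left h)), neg_sub_neg]
  -- Indices with `0 ≤ a i` involve only the first path and the others only the second, so the event
  -- is a product set for `Q ⊗ Q`. A degenerate interval at `0` counts as positive.
  rw [Finset.prod_congr rfl hone, Finset.prod_ite,
    ← hpos _ (fun i hi => hsets i (Finset.mem_filter.1 hi).1),
    ← hneg _ (fun i hi => hsets i (Finset.mem_filter.1 hi).1), ← Measure.prod_prod, twoSided,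
    Measure.map_apply measurable_glue (Finset.measurableSet_biInter S hmeas)]
  congr 1
  ext p
  simp only [Set.mem_preimage, Set.mem_iInter, Set.mem_prod, Finset.mem_filter, and_imp]
  constructor
  · refine fun h => ⟨fun i hi hai => ?_, fun i hi hai => ?_⟩
    · rw [← glue_sub_of_nonneg p hai (hab i)]; exact h i hi
    · rw [← glue_sub_of_nonpos p ((h0 i).resolve_left hai) (hab i)]; exact h i hi
  · intro h i hi
    by_cases hai : 0 ≤ a i
    · rw [glue_sub_of_nonneg p hai (hab i)]; exact h.1 i hi hai
    · rw [glue_sub_of_nonpos p ((h0 i).resolve_left hai) (hab i)]; exact h.2 i hi hai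

/-- The joint law of the increments of the two-sided process along a monotone sequence of times
passing through `0`. -/
theorem IsLevyProcess.map_twoSided_increments (hQ : IsLevyProcess (fun (t : ℝ≥0) w => w t) Q)
    {u : ℕ → ℝ} (hu : Monotone u) {k : ℕ} (hk : u k = 0) :
    (twoSided Q).map (fun w i => w.1 (u (i + 1)) - w.1 (u i))
      = Measure.infinitePi fun i => Q.map (fun w => w (u (i + 1) - u i).toNNReal) := by
  have h0 : ∀ i, 0 ≤ u i ∨ u (i + 1) ≤ 0 := by
    intro i
    rcases le_or_gt k i with h | h
    · exact Or.inl (hk ▸ hu h)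
    · exact Or.inr (hk ▸ hu h)
  have hind := hQ.iIndepFun_twoSided (a := u) (b := fun i => u (i + 1))
    (fun i => hu (Nat.le_succ i)) (fun i j hij => hu hij) h0
  rw [hind.map_fun_eq_infinitePi_map (fun i => by fun_prop)]
  congr 1
  funext i
  exact hQ.map_twoSided_sub (hu (Nat.le_succ i)) (h0 i)

/-- The sorted enumeration is continued as a constant past the last point, so that increments can be
indexed by `ℕ` whatever the cardinality. -/
theorem exists_monotone_enum (J : Finset ℝ) (hJ : J.Nonempty) :
    ∃ u : ℕ → ℝ, Monotone u ∧ ∀ s ∈ J, ∃ i, u i = s := by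
  have hpos : 0 < J.card := hJ.card_pos
  refine ⟨fun i => J.orderEmbOfFin rfl ⟨min i (J.card - 1), by omega⟩, fun i j hij => ?_, ?_⟩
  · refine (J.orderEmbOfFin rfl).monotone ?_
    simp only [Fin.mk_le_mk]
    omega
  · intro s hs
    obtain ⟨i, hi⟩ : s ∈ Set.range (J.orderEmbOfFin rfl) := by simpa using hs
    refine ⟨i, ?_⟩
    rw [← hi]
    exact congrArg _ (Fin.ext (min_eq_left (by omega)))

theorem IsLevyProcess.measurePreserving_incShift
    (hQ : IsLevyProcess (fun (t : ℝ≥0) w => w t) Q) (t : ℝ) :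
    MeasurePreserving (incShift t) (twoSided Q) (twoSided Q) := by
  classical
  refine ⟨(incShift t).measurable, ?_⟩
  -- Both laws are pushed to the full product space, where a measure is determined by its
  -- finite-dimensional marginals.
  have hemb : MeasurableEmbedding (Subtype.val : PathSpace d → ℝ → EuclideanSpace ℝ (Fin d)) :=
    MeasurableEmbedding.subtype_coe (measurableSet_eq_fun (by fun_prop) measurable_const)
  rw [← hemb.comap_map ((twoSided Q).map _), ← hemb.comap_map (twoSided Q)]
  congr 1
  rw [hemb.comap_map]
  have hm : Measurable (incShift (d := d) t) := (incShift t).measurable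
  have : IsProbabilityMeasure ((twoSided Q).map (incShift t)) :=
    Measure.isProbabilityMeasure_map hm.aemeasurable
  have := Measure.isProbabilityMeasure_map (μ := twoSided Q) hemb.measurable.aemeasurable
  refine IsProjectiveLimit.unique
    (P := fun I => ((twoSided Q).map Subtype.val).map I.restrict) (fun I => ?_) (fun I => rfl)
  -- The times contain `0` and `-t`, so that both `u` and `u + t` pass through `0` and no interval
  -- of either straddles it. The two increment laws then coincide, having the same lengths.
  obtain ⟨u, hu, hmem⟩ := exists_monotone_enum (insert 0 (insert (-t) I)) (by simp)
  obtain ⟨k, hk⟩ := hmem 0 (by simp)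
  obtain ⟨l, hl⟩ := hmem (-t) (by simp)
  have hI : ∀ s : I, ∃ i, u i = s := fun s => hmem s (by simp)
  choose m hm' using hI
  -- Since `w 0 = 0`, `w s` is a difference of two partial sums of increments, which works for
  -- either sign of `s`.
  let R : (ℕ → EuclideanSpace ℝ (Fin d)) → I → EuclideanSpace ℝ (Fin d) := fun x s =>
    ∑ i ∈ Finset.range (m s), x i - ∑ i ∈ Finset.range k, x i
  have hR : Measurable R := by fun_prop
  have h1 : (I.restrict ∘ Subtype.val : PathSpace d → I → EuclideanSpace ℝ (Fin d))
      = R ∘ fun w i => w.1 (u (i + 1)) - w.1 (u i) := by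
    funext w s
    simp only [R, Function.comp_apply, Finset.restrict]
    rw [Finset.sum_range_sub (fun i => w.1 (u i)), Finset.sum_range_sub (fun i => w.1 (u i)),
      hm', hk, w.2]
    simp
  have h2 : ((I.restrict ∘ Subtype.val) ∘ incShift t : PathSpace d → I → EuclideanSpace ℝ (Fin d))
      = R ∘ fun w i => w.1 (u (i + 1) + t) - w.1 (u i + t) := by
    funext w s
    simp only [R, Function.comp_apply, Finset.restrict]
    rw [Finset.sum_range_sub (fun i => w.1 (u i + t)), Finset.sum_range_sub (fun i => w.1 (u i + t)),
      hm', hk]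
    simp [incShift, incShiftFun]
  have hinc : ∀ v : ℕ → ℝ, Measurable fun (w : PathSpace d) i => w.1 (v (i + 1)) - w.1 (v i) :=
    fun v => by fun_prop
  have hrm : Measurable (I.restrict : (ℝ → EuclideanSpace ℝ (Fin d)) → _) :=
    Finset.measurable_restrict I
  change _ = ((twoSided Q).map Subtype.val).map I.restrict
  rw [Measure.map_map hrm hemb.measurable, Measure.map_map (hrm.comp hemb.measurable) hm,
    Measure.map_map hrm hemb.measurable, h2, h1,
    ← Measure.map_map hR (hinc u), ← Measure.map_map hR (hinc fun i => u i + t),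
    hQ.map_twoSided_increments hu hk,
    hQ.map_twoSided_increments (u := fun i => u i + t) (k := l)
      (fun i j hij => by simpa using hu hij) (by simp [hl])]
  simp

/-- Up to swapping the factors, this is a skew product over `η_t` whose fibre maps are translations.
-/
theorem IsLevyProcess.measurePreserving_shift
    (hQ : IsLevyProcess (fun (t : ℝ≥0) w => w t) Q) (t : ℝ) :
    MeasurePreserving (shift t) ((volume : Measure (EuclideanSpace ℝ (Fin d))).prod (twoSided Q))
      ((volume : Measure (EuclideanSpace ℝ (Fin d))).prod (twoSided Q)) := by
  have hmeas : Measurable (Function.uncurry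
      fun (w : PathSpace d) (x : EuclideanSpace ℝ (Fin d)) => x + w.1 t) :=
    measurable_snd.add ((measurable_eval t).comp measurable_fst)
  have h1 := (hQ.measurePreserving_incShift t).skew_product
    (g := fun (w : PathSpace d) (x : EuclideanSpace ℝ (Fin d)) => x + w.1 t)
    (μc := volume) (μd := volume) hmeas
    (ae_of_all _ fun w => map_add_right_eq_self volume (w.1 t))
  exact (Measure.measurePreserving_swap.comp h1).comp Measure.measurePreserving_swap

end Increments

/-! ### Weak continuity of the one-dimensional laws -/

section Continuity

variable {d : ℕ} {Q : Measure (ℝ≥0 → EuclideanSpace ℝ (Fin d))} [IsProbabilityMeasure Q]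

/-- A Lévy process is continuous in probability. -/
theorem IsLevyProcess.tendstoInMeasure (hQ : IsLevyProcess (fun (t : ℝ≥0) w => w t) Q) (t₀ : ℝ≥0) :
    TendstoInMeasure Q (fun (t : ℝ≥0) w => w t) (𝓝 t₀) (fun w => w t₀) := by
  intro ε hε
  have hr : Tendsto (fun t => nndist t t₀) (𝓝 t₀) (𝓝 0) := by
    have : Continuous fun t => nndist t t₀ := by fun_prop
    simpa using this.tendsto t₀
  refine ((hQ.tendsto ε hε).comp hr).congr fun t => ?_
  -- By stationarity, `w t - w s` has the law of `w (t - s)`, which reduces continuity at `t₀` to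
  -- continuity at `0`.
  have key : ∀ s t : ℝ≥0, s ≤ t → Q {w | ε ≤ edist (w (nndist t s)) 0}
      = Q {w | ε ≤ edist (w t) (w s)} := by
    intro s t hst
    have hpi : Measurable fun w : ℝ≥0 → EuclideanSpace ℝ (Fin d) => w (t - s) := by fun_prop
    have hms : MeasurableSet {x : EuclideanSpace ℝ (Fin d) | ε ≤ edist x 0} :=
      measurableSet_le measurable_const (by fun_prop)
    have h1 := congrArg (fun m => m {x : EuclideanSpace ℝ (Fin d) | ε ≤ edist x 0})
      (hQ.map_sub hst)
    simp only [Measure.map_apply (show Measurable fun w : ℝ≥0 → EuclideanSpace ℝ (Fin d) =>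
      w t - w s by fun_prop) hms, Measure.map_apply hpi hms] at h1
    have h2 : nndist t s = t - s := by
      ext
      rw [NNReal.coe_sub hst, coe_nndist, NNReal.dist_eq,
        abs_of_nonneg (sub_nonneg.2 (NNReal.coe_le_coe.2 hst))]
    rw [h2]
    refine h1.symm.trans ?_
    congr 1
    ext w
    simp [edist_eq_enorm_sub]
  rcases le_total t t₀ with h | h
  · simp only [Function.comp_apply]
    rw [nndist_comm, key t t₀ h]
    simp only [edist_comm]
  · exact key t₀ t h

/-- The one-dimensional laws of a Lévy process depend continuously on time. -/
theorem IsLevyProcess.continuous_integral_map (hQ : IsLevyProcess (fun (t : ℝ≥0) w => w t) Q)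
    {G : EuclideanSpace ℝ (Fin d) → ℂ} (hG : Continuous G) {C : ℝ} (hC : ∀ y, ‖G y‖ ≤ C) :
    Continuous fun t : ℝ≥0 => ∫ y, G y ∂(Q.map fun w => w t) := by
  have hmap : ∀ t : ℝ≥0, ∫ y, G y ∂(Q.map fun w => w t) = ∫ w, G (w t) ∂Q := fun t =>
    integral_map (measurable_pi_apply t).aemeasurable hG.aestronglyMeasurable
  simp only [hmap]
  -- Convergence in measure gives almost sure convergence along a subsequence of any sequence, and
  -- dominated convergence applies there.
  refine continuous_iff_continuousAt.2 fun t₀ => tendsto_of_subseq_tendsto fun ns hns => ?_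
  obtain ⟨ms, -, hms⟩ := ((hQ.tendstoInMeasure t₀).comp hns).exists_seq_tendsto_ae
  refine ⟨ms, tendsto_integral_of_dominated_convergence (fun _ => C) (fun n => ?_)
    (integrable_const C) (fun n => ae_of_all _ fun w => hC _) ?_⟩
  · have : Measurable fun w : ℝ≥0 → EuclideanSpace ℝ (Fin d) => w (ns (ms n)) := by fun_prop
    exact (hG.measurable.comp this).aestronglyMeasurable
  · filter_upwards [hms] with w hw
    exact (hG.tendsto _).comp hw

end Continuity

/-! ### Translations and matrix elements of `A ⊗ I` -/

section Translation

variable {d : ℕ}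

/-- The translation operator `ψ ↦ ψ (· - y)` on `L²(ℝ^d)`. -/
noncomputable def translation (y : EuclideanSpace ℝ (Fin d)) :
    Lp ℂ 2 (volume : Measure (EuclideanSpace ℝ (Fin d))) →L[ℂ]
      Lp ℂ 2 (volume : Measure (EuclideanSpace ℝ (Fin d))) :=
  koopman volume fun x => x - y

theorem coeFn_translation (y : EuclideanSpace ℝ (Fin d))
    (ψ : Lp ℂ 2 (volume : Measure (EuclideanSpace ℝ (Fin d)))) :
    translation y ψ =ᵐ[volume] fun x => ψ (x - y) :=
  coeFn_koopman (measurePreserving_sub_right volume y) ψ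

theorem translation_translation (y z : EuclideanSpace ℝ (Fin d))
    (ψ : Lp ℂ 2 (volume : Measure (EuclideanSpace ℝ (Fin d)))) :
    translation z (translation y ψ) = translation (y + z) ψ := by
  rw [translation, translation, koopman_koopman (measurePreserving_sub_right volume z)
    (measurePreserving_sub_right volume y)]
  congr 2
  funext x
  simp [sub_sub, add_comm]

theorem translation_zero (ψ : Lp ℂ 2 (volume : Measure (EuclideanSpace ℝ (Fin d)))) :
    translation 0 ψ = ψ := by
  rw [translation]
  simp only [sub_zero]
  exact koopman_id ψ

theorem norm_translation (y : EuclideanSpace ℝ (Fin d))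
    (ψ : Lp ℂ 2 (volume : Measure (EuclideanSpace ℝ (Fin d)))) :
    ‖translation y ψ‖ = ‖ψ‖ := by
  rw [translation, koopman_of_measurePreserving (measurePreserving_sub_right volume y)]
  exact LinearIsometry.norm_map _ ψ

theorem continuous_translation (ψ : Lp ℂ 2 (volume : Measure (EuclideanSpace ℝ (Fin d)))) :
    Continuous fun y => translation y ψ := by
  let g : C(EuclideanSpace ℝ (Fin d), C(EuclideanSpace ℝ (Fin d), EuclideanSpace ℝ (Fin d))) :=
    ContinuousMap.curry ⟨fun p => p.2 - p.1, by fun_prop⟩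
  have h := (continuous_const (y := ψ)).compMeasurePreservingLp g.continuous
    (fun y => measurePreserving_sub_right volume y) (by norm_num)
  refine h.congr fun y => ?_
  rw [translation, koopman_of_measurePreserving (measurePreserving_sub_right volume y)]
  rfl

theorem continuous_inner_translation
    (A : Lp ℂ 2 (volume : Measure (EuclideanSpace ℝ (Fin d))) →L[ℂ]
      Lp ℂ 2 (volume : Measure (EuclideanSpace ℝ (Fin d))))
    (φ ψ : Lp ℂ 2 (volume : Measure (EuclideanSpace ℝ (Fin d)))) :
    Continuous fun y => ⟪translation y φ, A (translation y ψ)⟫_ℂ :=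
  (continuous_translation φ).inner (A.continuous.comp (continuous_translation ψ))

theorem norm_inner_translation_le
    (A : Lp ℂ 2 (volume : Measure (EuclideanSpace ℝ (Fin d))) →L[ℂ]
      Lp ℂ 2 (volume : Measure (EuclideanSpace ℝ (Fin d))))
    (φ ψ : Lp ℂ 2 (volume : Measure (EuclideanSpace ℝ (Fin d)))) (y : EuclideanSpace ℝ (Fin d)) :
    ‖⟪translation y φ, A (translation y ψ)⟫_ℂ‖ ≤ ‖φ‖ * (‖A‖ * ‖ψ‖) := by
  refine (norm_inner_le_norm _ _).trans ?_
  rw [norm_translation]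
  gcongr
  exact (A.le_opNorm _).trans_eq (by rw [norm_translation])

/-- Distinct basis vectors are at distance `√2 > 1`, so the balls of radius `1/2` around them are
disjoint. -/
theorem HilbertBasis.countable_of_separableSpace {ι H : Type*} [NormedAddCommGroup H]
    [InnerProductSpace ℂ H] [TopologicalSpace.SeparableSpace H] (b : HilbertBasis ι ℂ H) :
    Countable ι := by
  have hd : Pairwise (Function.onFun Disjoint fun i => Metric.ball (b i) (1 / 2)) := by
    intro i j hij
    refine Metric.ball_disjoint_ball ?_
    have h1 : ‖b i - b j‖ ^ 2 = 2 := by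
      rw [@norm_sub_sq ℂ, b.orthonormal.1 i, b.orthonormal.1 j, b.orthonormal.2 hij]
      norm_num
    rw [dist_eq_norm]
    nlinarith [norm_nonneg (b i - b j)]
  exact hd.countable_of_isOpen_disjoint (fun i => Metric.isOpen_ball)
    fun i => ⟨b i, by simp⟩

theorem hasSum_norm_sq_inner {ι H : Type*} [NormedAddCommGroup H] [InnerProductSpace ℂ H]
    (b : HilbertBasis ι ℂ H) (x : H) : HasSum (fun i => ‖⟪x, b i⟫_ℂ‖ ^ 2) (‖x‖ ^ 2) := by
  have h1 := b.hasSum_inner_mul_inner x x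
  have h2 : ∀ i, ⟪x, b i⟫_ℂ * ⟪b i, x⟫_ℂ = ((‖⟪x, b i⟫_ℂ‖ ^ 2 : ℝ) : ℂ) := by
    intro i
    rw [← inner_conj_symm (b i) x, RCLike.mul_conj]
    simp
  simp only [h2, inner_self_eq_norm_sq_to_K] at h1
  refine Complex.hasSum_ofReal.1 ?_
  rw [Complex.ofReal_pow]
  exact h1

/-- Parseval's identity, integrated. -/
theorem hasSum_integral_inner_mul_inner {ι H β : Type*} [NormedAddCommGroup H]
    [InnerProductSpace ℂ H] [Countable ι] (b : HilbertBasis ι ℂ H) [MeasurableSpace β]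
    {ν : Measure β} [IsFiniteMeasure ν] {F G : β → H} (hF : StronglyMeasurable F)
    (hG : StronglyMeasurable G) {C D : ℝ} (hC : ∀ w, ‖F w‖ ≤ C) (hD : ∀ w, ‖G w‖ ≤ D) :
    HasSum (fun i => ∫ w, ⟪F w, b i⟫_ℂ * ⟪b i, G w⟫_ℂ ∂ν) (∫ w, ⟪F w, G w⟫_ℂ ∂ν) := by
  have hbsum : ∀ w, HasSum (fun i => (‖⟪F w, b i⟫_ℂ‖ ^ 2 + ‖⟪G w, b i⟫_ℂ‖ ^ 2))
      (‖F w‖ ^ 2 + ‖G w‖ ^ 2) := fun w =>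
    (hasSum_norm_sq_inner b _).add (hasSum_norm_sq_inner b _)
  -- The bound is `|ab| ≤ |a|² + |b|²`. By Parseval its sum over the basis is `‖F w‖² + ‖G w‖²`, at
  -- most `C² + D²`.
  refine hasSum_integral_of_dominated_convergence
    (fun i w => ‖⟪F w, b i⟫_ℂ‖ ^ 2 + ‖⟪G w, b i⟫_ℂ‖ ^ 2)
    (fun i => ?_) (fun i => ae_of_all _ fun w => ?_) (ae_of_all _ fun w => (hbsum w).summable) ?_
    (ae_of_all _ fun w => b.hasSum_inner_mul_inner _ _)
  · exact ((hF.inner stronglyMeasurable_const).mul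
      (stronglyMeasurable_const.inner hG)).aestronglyMeasurable
  · rw [norm_mul, ← inner_conj_symm (b i), RCLike.norm_conj]
    nlinarith [sq_nonneg (‖⟪F w, b i⟫_ℂ‖ - ‖⟪G w, b i⟫_ℂ‖), sq_nonneg ‖⟪F w, b i⟫_ℂ‖,
      sq_nonneg ‖⟪G w, b i⟫_ℂ‖]
  · simp only [(hbsum _).tsum_eq]
    refine Integrable.of_bound (C := C ^ 2 + D ^ 2)
      ((hF.norm.pow 2).add (hG.norm.pow 2)).aestronglyMeasurable (ae_of_all _ fun w => ?_)
    rw [Real.norm_of_nonneg (by positivity)]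
    gcongr
    exacts [hC w, hD w]

variable {β : Type*} [MeasurableSpace β] {ν : Measure β} [IsProbabilityMeasure ν]

/-- The slices of a randomly translated function. -/
theorem adjoint_tensor_of_ae_eq {z : β → EuclideanSpace ℝ (Fin d)} (hz : Measurable z)
    {ψ : Lp ℂ 2 (volume : Measure (EuclideanSpace ℝ (Fin d)))}
    {u : Lp ℂ 2 ((volume : Measure (EuclideanSpace ℝ (Fin d))).prod ν)}
    (hu : u =ᵐ[volume.prod ν] fun p => ψ (p.1 - z p.2))
    (a : Lp ℂ 2 (volume : Measure (EuclideanSpace ℝ (Fin d)))) :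
    (tensor volume ν a).adjoint u =ᵐ[ν] fun w => ⟪a, translation (z w) ψ⟫_ℂ := by
  have hF : MemLp (fun w => ⟪a, translation (z w) ψ⟫_ℂ) 2 ν := by
    refine MemLp.of_bound (C := ‖a‖ * ‖ψ‖) ?_ (ae_of_all _ fun w => ?_)
    · exact ((continuous_const.inner (continuous_translation ψ)).measurable.comp
        hz).aestronglyMeasurable
    · exact (norm_inner_le_norm _ _).trans_eq (by rw [norm_translation])
  suffices h : (tensor volume ν a).adjoint u = hF.toLp by
    rw [h]; exact hF.coeFn_toLp
  refine ext_inner_left ℂ fun k => ?_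
  rw [ContinuousLinearMap.adjoint_inner_right, L2.inner_def,
    integral_prod_symm _ (L2.integrable_inner _ _), L2.inner_def]
  refine integral_congr_ae ?_
  have hswap := (Measure.measurePreserving_swap (μ := ν)
    (ν := (volume : Measure (EuclideanSpace ℝ (Fin d))))).quasiMeasurePreserving.ae
      ((coeFn_tensor a k).and hu)
  filter_upwards [Measure.ae_ae_of_ae_prod hswap, hF.coeFn_toLp] with w hw hFw
  rw [hFw, L2.inner_def, RCLike.inner_apply, ← integral_mul_const]
  refine integral_congr_ae ?_
  filter_upwards [hw, coeFn_translation (z w) ψ] with x hx hτ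
  have h1 := hx.1
  have h2 := hx.2
  simp only [Prod.swap_prod_mk] at h1 h2
  rw [h1, h2, hτ]
  simp only [RCLike.inner_apply, map_mul]
  ring

/-- Slicing in the first factor moves `A` onto the fixed vector `a` as its adjoint, after which both
slices are explicit functions of `w`. -/
theorem inner_adjoint_tensor_tensorOp {z : β → EuclideanSpace ℝ (Fin d)} (hz : Measurable z)
    {φ ψ : Lp ℂ 2 (volume : Measure (EuclideanSpace ℝ (Fin d)))}
    {u v : Lp ℂ 2 ((volume : Measure (EuclideanSpace ℝ (Fin d))).prod ν)}
    (hu : u =ᵐ[volume.prod ν] fun p => φ (p.1 - z p.2))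
    (hv : v =ᵐ[volume.prod ν] fun p => ψ (p.1 - z p.2))
    (A : Lp ℂ 2 (volume : Measure (EuclideanSpace ℝ (Fin d))) →L[ℂ]
      Lp ℂ 2 (volume : Measure (EuclideanSpace ℝ (Fin d))))
    (a : Lp ℂ 2 (volume : Measure (EuclideanSpace ℝ (Fin d)))) :
    ⟪(tensor volume ν a).adjoint u, (tensor volume ν a).adjoint (tensorOp volume ν A 1 v)⟫_ℂ
      = ∫ w, ⟪translation (z w) φ, a⟫_ℂ * ⟪a, A (translation (z w) ψ)⟫_ℂ ∂ν := by
  rw [adjoint_tensor_tensorOp, L2.inner_def]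
  refine integral_congr_ae ?_
  filter_upwards [adjoint_tensor_of_ae_eq hz hu a,
    adjoint_tensor_of_ae_eq hz hv (A.adjoint a)] with w h1 h2
  have h3 := A.adjoint_inner_left (translation (z w) ψ) a
  rw [h1, h2, h3, RCLike.inner_apply, inner_conj_symm]
  exact mul_comm _ _

theorem separableSpace_L2 :
    TopologicalSpace.SeparableSpace (Lp ℂ 2 (volume : Measure (EuclideanSpace ℝ (Fin d)))) := by
  have : Fact ((2 : ℝ≥0∞) ≠ ∞) := ⟨by norm_num⟩
  infer_instance

/-- The matrix elements of `A ⊗ I` between randomly translated functions. -/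
theorem inner_tensorOp_of_ae_eq {z : β → EuclideanSpace ℝ (Fin d)} (hz : Measurable z)
    {φ ψ : Lp ℂ 2 (volume : Measure (EuclideanSpace ℝ (Fin d)))}
    {u v : Lp ℂ 2 ((volume : Measure (EuclideanSpace ℝ (Fin d))).prod ν)}
    (hu : u =ᵐ[volume.prod ν] fun p => φ (p.1 - z p.2))
    (hv : v =ᵐ[volume.prod ν] fun p => ψ (p.1 - z p.2))
    (A : Lp ℂ 2 (volume : Measure (EuclideanSpace ℝ (Fin d))) →L[ℂ]
      Lp ℂ 2 (volume : Measure (EuclideanSpace ℝ (Fin d)))) :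
    ⟪u, tensorOp volume ν A 1 v⟫_ℂ
      = ∫ w, ⟪translation (z w) φ, A (translation (z w) ψ)⟫_ℂ ∂ν := by
  obtain ⟨s, b, -⟩ := exists_hilbertBasis ℂ (Lp ℂ 2 (volume : Measure (EuclideanSpace ℝ (Fin d))))
  have := separableSpace_L2 (d := d)
  have : Countable s := HilbertBasis.countable_of_separableSpace b
  have hF : StronglyMeasurable fun w => translation (z w) φ :=
    (continuous_translation φ).comp_stronglyMeasurable hz.stronglyMeasurable
  have hG : StronglyMeasurable fun w => A (translation (z w) ψ) :=
    (A.continuous.comp (continuous_translation ψ)).comp_stronglyMeasurable hz.stronglyMeasurable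
  -- A general `A` has no kernel to integrate, so both sides are expanded along one basis of `L²(λ)`
  -- and compared term by term.
  have h1 := hasSum_inner_adjoint_tensor b u (tensorOp volume ν A 1 v)
  have h2 := hasSum_integral_inner_mul_inner (ν := ν) b hF hG
    (fun w => (norm_translation (z w) φ).le)
    (fun w => (A.le_opNorm _).trans_eq (congrArg _ (norm_translation (z w) ψ)))
  exact h1.unique (h2.congr_fun fun i => inner_adjoint_tensor_tensorOp hz hu hv A (b i))

end Translation

/-! ### The cocycle and the averaging formula -/

section Cocycle

variable {d : ℕ} {Q : Measure (ℝ≥0 → EuclideanSpace ℝ (Fin d))} [IsProbabilityMeasure Q]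

theorem IsLevyProcess.cocycle_eq_koopman (hQ : IsLevyProcess (fun (t : ℝ≥0) w => w t) Q) (t : ℝ) :
    MeasurePreserving ((shift t).symm ∘ Prod.map id (incShift (-t)))
      ((volume : Measure (EuclideanSpace ℝ (Fin d))).prod (twoSided Q))
      ((volume : Measure (EuclideanSpace ℝ (Fin d))).prod (twoSided Q)) ∧
    cocycle Q t = koopman _ ((shift t).symm ∘ Prod.map id (incShift (-t))) := by
  have h1 : ∀ s : ℝ, MeasurePreserving (Prod.map id (incShift s))
      ((volume : Measure (EuclideanSpace ℝ (Fin d))).prod (twoSided Q))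
      ((volume : Measure (EuclideanSpace ℝ (Fin d))).prod (twoSided Q)) := fun s =>
    (MeasurePreserving.id volume).prod (hQ.measurePreserving_incShift s)
  have h2 := (hQ.measurePreserving_shift t).symm
  refine ⟨h2.comp (h1 (-t)), ?_⟩
  ext1 u
  rw [cocycle, incShiftOp, tensorOp_one_koopman (hQ.measurePreserving_incShift t),
    adjoint_koopman (h1 t) (h1 (-t)), ContinuousLinearMap.comp_apply, shiftOp,
    koopman_koopman (h1 (-t)) h2]
  funext p
  exact Prod.ext rfl (incShiftFun_incShiftFun (by simp) p.2)

theorem IsLevyProcess.adjoint_cocycle_comp_cocycle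
    (hQ : IsLevyProcess (fun (t : ℝ≥0) w => w t) Q) (t : ℝ) :
    (cocycle Q t).adjoint ∘L cocycle Q t = 1 := by
  rw [(hQ.cocycle_eq_koopman t).2]
  exact adjoint_koopman_comp_koopman (hQ.cocycle_eq_koopman t).1

theorem IsLevyProcess.coeFn_cocycle_tensor_const
    (hQ : IsLevyProcess (fun (t : ℝ≥0) w => w t) Q) (t : ℝ)
    (ψ : Lp ℂ 2 (volume : Measure (EuclideanSpace ℝ (Fin d)))) :
    cocycle Q t (tensor volume (twoSided Q) ψ (Lp.const 2 (twoSided Q) 1))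
      =ᵐ[volume.prod (twoSided Q)] fun p => ψ (p.1 - (p.2.1 (-t) - p.2.1 (-t + -t))) := by
  obtain ⟨hT, hc⟩ := hQ.cocycle_eq_koopman t
  rw [hc]
  have h1 : tensor volume (twoSided Q) ψ (Lp.const 2 (twoSided Q) 1)
      =ᵐ[volume.prod (twoSided Q)] fun p => ψ p.1 := by
    filter_upwards [coeFn_tensor ψ (Lp.const 2 (twoSided Q) (1 : ℂ)),
      Measure.quasiMeasurePreserving_snd.ae (Lp.coeFn_const 2 (twoSided Q) (1 : ℂ))] with p h1 h2
    rw [h1, h2]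
    simp
  filter_upwards [coeFn_koopman hT (tensor volume (twoSided Q) ψ (Lp.const 2 (twoSided Q) 1)),
    hT.quasiMeasurePreserving.ae h1] with p h2 h3
  rw [h2, Function.comp_apply, h3]
  congr 1
  change p.1 + (p.2.1 (-t + -t) - p.2.1 (-t)) = _
  abel

/-- The quantum semigroup averages `A` over translations distributed according to the Lévy
process. -/
theorem IsLevyProcess.inner_levyQMS (hQ : IsLevyProcess (fun (t : ℝ≥0) w => w t) Q) (t : ℝ≥0)
    (A : Lp ℂ 2 (volume : Measure (EuclideanSpace ℝ (Fin d))) →L[ℂ]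
      Lp ℂ 2 (volume : Measure (EuclideanSpace ℝ (Fin d))))
    (φ ψ : Lp ℂ 2 (volume : Measure (EuclideanSpace ℝ (Fin d)))) :
    ⟪φ, levyQMS Q t A ψ⟫_ℂ
      = ∫ y, ⟪translation y φ, A (translation y ψ)⟫_ℂ ∂(Q.map fun w => w t) := by
  have hz : Measurable fun w : PathSpace d => w.1 (-(t : ℝ)) - w.1 (-(t : ℝ) + -t) := by fun_prop
  -- The displacement is the increment over `[-2t, -t]`, which lies to the left of `0` and has
  -- length `t`.
  have hlaw := hQ.map_twoSided_sub (s := -(t : ℝ) + -t) (t := -(t : ℝ))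
    (by linarith [t.coe_nonneg]) (Or.inr (by linarith [t.coe_nonneg]))
  rw [show (-(t : ℝ) - (-t + -t)).toNNReal = t by simp] at hlaw
  rw [levyQMS, inner_partialTrace, ContinuousLinearMap.comp_apply, ContinuousLinearMap.comp_apply,
    ContinuousLinearMap.adjoint_inner_right,
    inner_tensorOp_of_ae_eq hz (hQ.coeFn_cocycle_tensor_const t φ)
      (hQ.coeFn_cocycle_tensor_const t ψ),
    ← hlaw, integral_map hz.aemeasurable
      (continuous_inner_translation A φ ψ).aestronglyMeasurable]

end Cocycle

/-! ### The quantum Markov semigroup properties -/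

section QMS

variable {d : ℕ} {Q : Measure (ℝ≥0 → EuclideanSpace ℝ (Fin d))} [IsProbabilityMeasure Q]

theorem integrable_inner_translation {μ : Measure (EuclideanSpace ℝ (Fin d))} [IsFiniteMeasure μ]
    (A : Lp ℂ 2 (volume : Measure (EuclideanSpace ℝ (Fin d))) →L[ℂ]
      Lp ℂ 2 (volume : Measure (EuclideanSpace ℝ (Fin d))))
    (φ ψ : Lp ℂ 2 (volume : Measure (EuclideanSpace ℝ (Fin d)))) :
    Integrable (fun y => ⟪translation y φ, A (translation y ψ)⟫_ℂ) μ :=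
  Integrable.of_bound (continuous_inner_translation A φ ψ).aestronglyMeasurable _
    (ae_of_all _ (norm_inner_translation_le A φ ψ))

instance (t : ℝ≥0) :
    IsProbabilityMeasure (Q.map fun w : ℝ≥0 → EuclideanSpace ℝ (Fin d) => w t) :=
  Measure.isProbabilityMeasure_map (measurable_pi_apply t).aemeasurable

theorem IsLevyProcess.levyQMS_one (hQ : IsLevyProcess (fun (t : ℝ≥0) w => w t) Q) (t : ℝ≥0) :
    levyQMS Q t 1 = 1 := by
  refine partialTrace_one ?_ (hQ.adjoint_cocycle_comp_cocycle t)
  rw [Lp.norm_const _ _ _ (by norm_num)]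
  simp

theorem IsLevyProcess.isQuantumMarkovSemigroup
    (hQ : IsLevyProcess (fun (t : ℝ≥0) w => w t) Q) : IsQuantumMarkovSemigroup (levyQMS Q) := by
  obtain ⟨s, b, -⟩ := exists_hilbertBasis ℂ (Lp ℂ 2 (twoSided Q))
  have hK := fun t : ℝ≥0 => hasKraus_partialTrace
    (μ := (volume : Measure (EuclideanSpace ℝ (Fin d)))) (Lp.const 2 (twoSided Q) 1)
    (cocycle Q t) b
  refine ⟨fun t => (hK t).exists_completelyPositiveMap, fun t => (hK t).continuous (hQ.levyQMS_one t),
    hQ.levyQMS_one, fun A => ?_, fun s t A => ?_, fun A => ?_⟩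
  · ext1 ψ
    refine ext_inner_left ℂ fun φ => ?_
    rw [hQ.inner_levyQMS, hQ.map_zero, integral_dirac, translation_zero, translation_zero]
  · ext1 ψ
    refine ext_inner_left ℂ fun φ => ?_
    -- Swapping `s` and `t` makes the outer integral of the convolution run over the law at time
    -- `s`, as in `𝒫_s (𝒫_t A)`.
    rw [hQ.inner_levyQMS, hQ.inner_levyQMS, add_comm s t, hQ.map_add,
      integral_conv (integrable_inner_translation A φ ψ)]
    refine integral_congr_ae (ae_of_all _ fun y => ?_)
    simp only [hQ.inner_levyQMS t, translation_translation]
  · refine continuous_iInf_rng.2 fun ⟨⟨φ, ψ⟩, hφ, hψ⟩ => continuous_induced_rng.2 ?_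
    -- A bound uniform in `t` and summable in `n` carries continuity of the matrix elements over to
    -- the trace class series.
    have hb : ∀ n (t : ℝ≥0), ‖⟪φ n, levyQMS Q t A (ψ n)⟫_ℂ‖ ≤ ‖φ n‖ * (‖A‖ * ‖ψ n‖) := by
      intro n t
      rw [hQ.inner_levyQMS]
      simpa using norm_integral_le_of_norm_le_const (μ := Q.map fun w => w t)
        (ae_of_all _ (norm_inner_translation_le A (φ n) (ψ n)))
    refine continuous_tsum (u := fun n => ‖φ n‖ * (‖A‖ * ‖ψ n‖)) (fun n => ?_) ?_ hb
    · simp only [hQ.inner_levyQMS]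
      exact hQ.continuous_integral_map (continuous_inner_translation A (φ n) (ψ n))
        (norm_inner_translation_le A (φ n) (ψ n))
    · refine Summable.of_nonneg_of_le (fun n => by positivity) (fun n => ?_)
        ((hφ.add hψ).mul_left ‖A‖)
      have h1 : ‖φ n‖ * ‖ψ n‖ ≤ ‖φ n‖ ^ 2 + ‖ψ n‖ ^ 2 := by
        nlinarith [sq_nonneg (‖φ n‖ - ‖ψ n‖), sq_nonneg ‖φ n‖, sq_nonneg ‖ψ n‖]
      nlinarith [mul_le_mul_of_nonneg_left h1 (norm_nonneg A)]

end QMS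

/-! ### Restriction to multiplication operators -/

section Multiplication

theorem coeFn_mulOp {α : Type*} [MeasurableSpace α] {μ : Measure α} (f : Lp ℂ ∞ μ) (h : Lp ℂ 2 μ) :
    mulOp μ f h =ᵐ[μ] fun x => f x * h x := by
  rw [mulOp, ContinuousLinearMap.holderL_apply_apply]
  exact ContinuousLinearMap.coeFn_holder _ f h

/-- An essentially bounded function has a bounded measurable version. -/
theorem exists_bounded_measurable_version {α : Type*} [MeasurableSpace α] {μ : Measure α}
    (f : Lp ℂ ∞ μ) : ∃ g : α → ℂ, Measurable g ∧ (∃ C : ℝ, ∀ x, ‖g x‖ ≤ C) ∧ f =ᵐ[μ] g := by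
  have hf : Measurable f := (Lp.stronglyMeasurable f).measurable
  have hs : MeasurableSet {x | ‖f x‖ ≤ ‖f‖} := measurableSet_le hf.norm measurable_const
  refine ⟨Set.indicator {x | ‖f x‖ ≤ ‖f‖} f, hf.indicator hs, ⟨‖f‖, fun x => ?_⟩, ?_⟩
  · by_cases hx : x ∈ {x | ‖f x‖ ≤ ‖f‖}
    · rw [Set.indicator_of_mem hx]; exact hx
    · rw [Set.indicator_of_notMem hx, norm_zero]; exact norm_nonneg f
  · filter_upwards [enorm_ae_le_eLpNormEssSup f μ] with x hx
    have h1 : ‖f x‖ ≤ ‖f‖ := by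
      rw [Lp.norm_def, eLpNorm_exponent_top, ← toReal_enorm]
      exact ENNReal.toReal_mono (by simpa using Lp.eLpNorm_ne_top f) hx
    rw [Set.indicator_of_mem (s := {x | ‖f x‖ ≤ ‖f‖}) h1]

variable {d : ℕ} {Q : Measure (ℝ≥0 → EuclideanSpace ℝ (Fin d))} [IsProbabilityMeasure Q]

/-- The semigroup of a Lévy process is given by convolution with its one-dimensional laws. -/
theorem IsSemigroupOf.ae_eq_integral {Ω : Type*} [MeasurableSpace Ω] {Pr : Measure Ω}
    {X : ℝ≥0 → Ω → EuclideanSpace ℝ (Fin d)}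
    {P : ℝ≥0 → Lp ℂ ∞ (volume : Measure (EuclideanSpace ℝ (Fin d))) →
      Lp ℂ ∞ (volume : Measure (EuclideanSpace ℝ (Fin d)))}
    (hP : IsSemigroupOf Pr X P) (hX : IsLebesgueLevy Pr X Q) (t : ℝ≥0)
    {f : Lp ℂ ∞ (volume : Measure (EuclideanSpace ℝ (Fin d)))}
    {g : EuclideanSpace ℝ (Fin d) → ℂ} (hg : Measurable g) {C : ℝ} (hC : ∀ x, ‖g x‖ ≤ C)
    (hfg : f =ᵐ[volume] g) :
    P t f =ᵐ[volume] fun x => ∫ y, g (x + y) ∂(Q.map fun w => w t) := by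
  have hm : StronglyMeasurable fun x => ∫ y, g (x + y) ∂(Q.map fun w => w t) :=
    (hg.comp (measurable_fst.add measurable_snd)).stronglyMeasurable.integral_prod_right'
  have hb : ∀ x, ‖∫ y, g (x + y) ∂(Q.map fun w => w t)‖ ≤ C := fun x => by
    simpa using norm_integral_le_of_norm_le_const (μ := Q.map fun w => w t)
      (ae_of_all _ fun y => hC (x + y))
  refine ae_eq_of_forall_setIntegral_eq_of_sigmaFinite (fun A hA hμA => ?_) (fun A hA hμA => ?_)
    fun A hA hμA => ?_
  · exact integrableOn_Lp_of_measure_ne_top _ (by norm_num) hμA.ne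
  · have : IsFiniteMeasure ((volume : Measure (EuclideanSpace ℝ (Fin d))).restrict A) :=
      ⟨by simpa using hμA⟩
    exact Integrable.of_bound hm.aestronglyMeasurable C (ae_of_all _ hb)
  -- Starting time `0` suffices: on `{X_0 ∈ A}` the law `λ ⊗ Q` of `X_0` and the increments turns
  -- the conditional expectation into an integral over `A` and the law of `Y_t`.
  · have h1 := hP 0 t f A hA hμA
    have hX0 := hX.preserving 0
    have h2 : ∫ x in A, P t f x = ∫ ω in X 0 ⁻¹' A, P t f (X 0 ω) ∂Pr := by
      rw [← setIntegral_map hA (hX0.map_eq.symm ▸ Lp.aestronglyMeasurable _)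
        hX0.measurable.aemeasurable, hX0.map_eq]
    rw [h2, h1, zero_add]
    have h3 : ∀ᵐ ω ∂Pr, f (X t ω) = g (X t ω) := (hX.preserving t).quasiMeasurePreserving.ae hfg
    have hpm : Measurable fun ω => (X 0 ω, fun s => X s ω - X 0 ω) :=
      hX0.measurable.prodMk (measurable_pi_lambda _ fun s =>
        (hX.preserving s).measurable.sub hX0.measurable)
    have hgm : Measurable fun p : EuclideanSpace ℝ (Fin d) × (ℝ≥0 → EuclideanSpace ℝ (Fin d)) =>
        g (p.1 + p.2 t) :=
      hg.comp (measurable_fst.add ((measurable_pi_apply t).comp measurable_snd))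
    have h4 := setIntegral_map (hA.prod MeasurableSet.univ) (μ := Pr)
      (f := fun p : EuclideanSpace ℝ (Fin d) × (ℝ≥0 → EuclideanSpace ℝ (Fin d)) => g (p.1 + p.2 t))
      hgm.aestronglyMeasurable hpm.aemeasurable
    rw [hX.law] at h4
    have h5 : (fun ω => (X 0 ω, fun s => X s ω - X 0 ω)) ⁻¹' (A ×ˢ (Set.univ :
        Set (ℝ≥0 → EuclideanSpace ℝ (Fin d)))) = X 0 ⁻¹' A := by
      ext ω; simp
    rw [h5] at h4
    simp only [add_sub_cancel] at h4
    rw [integral_congr_ae (ae_restrict_of_ae h3), ← h4, setIntegral_prod]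
    · refine integral_congr_ae (ae_of_all _ fun x => ?_)
      simp only [Measure.restrict_univ]
      have hgx : Measurable fun y => g (x + y) := hg.comp (measurable_const_add x)
      exact (integral_map (μ := Q) (measurable_pi_apply t).aemeasurable
        hgx.aestronglyMeasurable).symm
    · have : IsFiniteMeasure ((volume.prod Q).restrict (A ×ˢ (Set.univ :
          Set (ℝ≥0 → EuclideanSpace ℝ (Fin d))))) := ⟨by simpa using hμA⟩
      exact Integrable.of_bound hgm.aestronglyMeasurable C (ae_of_all _ fun p => hC _)

theorem inner_translation_mulOp {f : Lp ℂ ∞ (volume : Measure (EuclideanSpace ℝ (Fin d)))}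
    {g : EuclideanSpace ℝ (Fin d) → ℂ} (hfg : f =ᵐ[volume] g)
    (φ ψ : Lp ℂ 2 (volume : Measure (EuclideanSpace ℝ (Fin d)))) (y : EuclideanSpace ℝ (Fin d)) :
    ⟪translation y φ, mulOp volume f (translation y ψ)⟫_ℂ = ∫ x, ⟪φ x, ψ x⟫_ℂ * g (x + y) := by
  rw [L2.inner_def, ← integral_sub_right_eq_self (fun x => ⟪φ x, ψ x⟫_ℂ * g (x + y)) y]
  refine integral_congr_ae ?_
  filter_upwards [coeFn_translation y φ, coeFn_translation y ψ,
    coeFn_mulOp f (translation y ψ), hfg] with x h1 h2 h3 h4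
  rw [h1, h3, h2, h4]
  simp only [RCLike.inner_apply, sub_add_cancel]
  ring

/-- Conjugating multiplication by `f` with a translation shifts the argument of `f`. Fubini then
exchanges the average over `y` with the `L²` inner product. -/
theorem IsLevyProcess.levyQMS_mulOp (hQ : IsLevyProcess (fun (t : ℝ≥0) w => w t) Q) (t : ℝ≥0)
    {f f' : Lp ℂ ∞ (volume : Measure (EuclideanSpace ℝ (Fin d)))}
    {g : EuclideanSpace ℝ (Fin d) → ℂ} (hg : Measurable g) {C : ℝ} (hC : ∀ x, ‖g x‖ ≤ C)
    (hfg : f =ᵐ[volume] g)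
    (hf' : f' =ᵐ[volume] fun x => ∫ y, g (x + y) ∂(Q.map fun w => w t)) :
    levyQMS Q t (mulOp volume f) = mulOp volume f' := by
  ext1 ψ
  refine ext_inner_left ℂ fun φ => ?_
  rw [hQ.inner_levyQMS]
  simp only [inner_translation_mulOp hfg]
  rw [integral_integral_swap, L2.inner_def]
  · refine integral_congr_ae ?_
    filter_upwards [coeFn_mulOp f' ψ, hf'] with x h1 h2
    rw [h1, h2, integral_const_mul]
    simp only [RCLike.inner_apply]
    ring
  · refine Integrable.mul_bdd (c := C) ?_ ?_ (ae_of_all _ fun p => hC _)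
    · exact (L2.integrable_inner (𝕜 := ℂ) φ ψ).comp_snd (Q.map fun w => w t)
    · exact (hg.comp (measurable_snd.add measurable_fst)).aestronglyMeasurable

end Multiplication

end LevyQuantum

theorem mainTheorem1 {d : ℕ} {Ω : Type*} [MeasurableSpace Ω] (Pr : Measure Ω)
    (X : ℝ≥0 → Ω → EuclideanSpace ℝ (Fin d))
    (Q : Measure (ℝ≥0 → EuclideanSpace ℝ (Fin d)))
    [IsProbabilityMeasure Q]
    (hX : LevyQuantum.IsLebesgueLevy Pr X Q)
    (P : ℝ≥0 → Lp ℂ ∞ (volume : Measure (EuclideanSpace ℝ (Fin d))) →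
      Lp ℂ ∞ (volume : Measure (EuclideanSpace ℝ (Fin d))))
    (hP : LevyQuantum.IsSemigroupOf Pr X P) :
    (∀ t : ℝ, MeasurePreserving (LevyQuantum.incShift t)
      (LevyQuantum.twoSided Q) (LevyQuantum.twoSided Q)) ∧
    (∀ t : ℝ, MeasurePreserving (LevyQuantum.shift t)
      ((volume : Measure (EuclideanSpace ℝ (Fin d))).prod (LevyQuantum.twoSided Q))
      ((volume : Measure (EuclideanSpace ℝ (Fin d))).prod (LevyQuantum.twoSided Q))) ∧
    LevyQuantum.IsQuantumMarkovSemigroup (LevyQuantum.levyQMS Q) ∧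
    ∀ (t : ℝ≥0) (f : Lp ℂ ∞ (volume : Measure (EuclideanSpace ℝ (Fin d)))),
      LevyQuantum.levyQMS Q t (LevyQuantum.mulOp volume f) =
        LevyQuantum.mulOp volume (P t f) := by
  have hQ := hX.levy
  refine ⟨hQ.measurePreserving_incShift, hQ.measurePreserving_shift,
    hQ.isQuantumMarkovSemigroup, fun t f => ?_⟩
  -- The version `g` is bounded everywhere, not just almost everywhere, since `g (x + y)` is
  -- integrated in `y` against laws that may be singular to Lebesgue measure.
  obtain ⟨g, hg, ⟨C, hC⟩, hfg⟩ := LevyQuantum.exists_bounded_measurable_version f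
  exact hQ.levyQMS_mulOp t hg hC hfg (hP.ae_eq_integral hX t hg hC hfg)
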